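/- Let $N \ge 2$ be an integer. Then there exist a probability space $(\Omega,\mathcal F,P)$ and a strictly stationary sequence $X=(X_k,\ k\in\mathbb Z)$ of real random variables on it (that is, for all integers $j,\ell$ and all $m\ge 0$ the vectors $(X_j,\dots,X_{j+m})$ and $(X_\ell,\dots,X_{\ell+m})$ have the same distribution) such that, with $S_n := X_1+\dots+X_n$ for $n\in\mathbb N=\{1,2,\dots\}$, the following hold. (A) $X_0$ is uniformly distributed on $[-\sqrt3,\sqrt3]$ (and hence $EX_0=0$ and $EX_0^2=1$). (B) For every choice of $N$ distinct integers $k(1),\dots,k(N)$, the random variables $X_{k(1)},\dots,X_{k(N)}$ are independent. (C) The random variables $|X_k|$, $k\in\mathbb Z$, are independent and identically distributed. (D) For every infinite set $Q\subset\mathbb N$ there exist an infinite set $T\subset Q$ and a probability measure $\mu$ on the Borel sets of $\mathbb R$ that is nondegenerate (not a point mass) and non-normal, such that $S_n/\sqrt n$ converges in distribution to $\mu$ as $n\to\infty$, $n\in T$. (E) Consequently, for no infinite set $Q\subset\mathbb N$ do there exist constants $a_n>0$ and $b_n\in\mathbb R$ $(n\in Q)$ such that $a_nS_n+b_n$ converges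 in distribution to the standard normal law $N(0,1)$ as $n\to\infty$, $n\in Q$. -/

import Mathlib

open MeasureTheory ProbabilityTheory Filter

/-- A two-sided sequence of real random variables is strictly stationary if, for all integers
`j`, `l` and every natural number `m`, the random vectors `(X_j, ..., X_{j+m})` and
`(X_l, ..., X_{l+m})` have the same distribution. -/
def StrictlyStationary {Ω : Type*} [MeasurableSpace Ω] (P : Measure Ω) (X : ℤ → Ω → ℝ) : Prop :=
  ∀ (j l : ℤ) (m : ℕ),
    IdentDistrib (fun ω (i : Fin (m + 1)) => X (j + (i : ℕ)) ω)
      (fun ω (i : Fin (m + 1)) => X (l + (i : ℕ)) ω) P P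

/-- `N`-tuplewise independence: every choice of `N` distinct indices gives independent random
variables. -/
def TuplewiseIndep {Ω : Type*} [MeasurableSpace Ω] (P : Measure Ω) (N : ℕ) (X : ℤ → Ω → ℝ) :
    Prop :=
  ∀ k : Fin N → ℤ, Function.Injective k → iIndepFun (fun i => X (k i)) P

/-- The partial sum `S_n = X_1 + ... + X_n`. -/
def partialSum {Ω : Type*} (X : ℤ → Ω → ℝ) (n : ℕ) (ω : Ω) : ℝ :=
  ∑ k ∈ Finset.Icc 1 n, X (k : ℤ) ω

/-- Convergence in distribution of the real random variables `Y n` to the probability measure `μ`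
as `n → ∞` along the set `T` of natural numbers. -/
def TendstoInLawAlong {Ω : Type*} [MeasurableSpace Ω] (P : Measure Ω) [IsProbabilityMeasure P]
    (Y : ℕ → Ω → ℝ) (T : Set ℕ) (μ : Measure ℝ) [IsProbabilityMeasure μ] : Prop :=
  TendstoInDistribution Y (atTop ⊓ 𝓟 T) (id : ℝ → ℝ) (fun _ => P) μ

/-! Put `L = 2 * N`. Start from i.i.d. uniform states and build laws `blockLaw L J` recursively:
glue `L` independent copies of the level `J` law along consecutive blocks of length `L ^ J`, with
density `1 + ∏ sgn(S_i)`, where `S_i` is the sum over the `i`-th block. Since `L` is even, every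
such law is invariant under a global change of sign, so each `sgn(S_i)` has mean zero and the
density has mass one.

The reweighting is invisible unless a function involves the sign of every block at once. A product
of fewer than `L` one-coordinate functions misses some block, and a product of even functions is
even in each block; in both cases the correction term contains a vanishing factor
(`integral_blockLaw_prod_eq`). Hence fewer than `L` coordinates, and all absolute values jointly,
behave as in the i.i.d. case, and so do the moments of order below `L` of partial sums. The `L`-th
moment does change: each block contributes `E|S_i|` to the correction, all corrections are
nonnegative for nonnegative weights, and a window of length `n` contains an aligned block of
comparable length, so the `L`-th moment of its sum exceeds the i.i.d. value by at least a constant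
times `n ^ (L / 2)` (`window_pow_gap`).

Averaging translates over one block and passing to a weak limit gives a stationary law with the same
properties. An exponential moment bound, uniform in the level (`integral_exp_linForm_blockLaw_le`),
makes the laws of `S_n / √n` tight and makes moments converge along weakly convergent subsequences.
A normal limit would have the first two moments of `N(0,1)`, hence be `N(0,1)`, but its `L`-th
moment is too large (`ne_gaussianReal_of_tendsto_normalizedLaw`). The affine statement follows by a
convergence-of-types argument (`exists_eq_gaussianReal_of_tendsto`). -/

/-! ### The uniform law on `[-√3, √3]`. -/

/-- The compact state space `[-√3, √3]`. -/
abbrev Spin : Type := Set.Icc (-√3 : ℝ) √3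

/-- Change of sign on the state space. -/
def Spin.flip (s : Spin) : Spin := ⟨-s.1, by constructor <;> linarith [s.2.1, s.2.2]⟩

@[simp] lemma Spin.coe_flip (s : Spin) : (s.flip : ℝ) = -s := rfl

lemma Spin.measurable_flip : Measurable Spin.flip :=
  Measurable.subtype_mk (by fun_prop)

lemma Spin.abs_coe_le (s : Spin) : |(s : ℝ)| ≤ √3 := abs_le.2 ⟨s.2.1, s.2.2⟩

/-- The uniform distribution on the state space. -/
noncomputable def spinLaw : Measure Spin :=
  (ProbabilityTheory.cond volume (Set.Icc (-√3 : ℝ) √3)).comap Subtype.val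

lemma volume_Icc_sqrt_three : volume (Set.Icc (-√3 : ℝ) √3) = ENNReal.ofReal (2 * √3) := by
  rw [Real.volume_Icc]; congr 1; ring

lemma volume_Icc_sqrt_three_ne_zero : volume (Set.Icc (-√3 : ℝ) √3) ≠ 0 := by
  rw [volume_Icc_sqrt_three]; simp

lemma map_val_spinLaw :
    spinLaw.map (Subtype.val : Spin → ℝ) = ProbabilityTheory.cond volume (Set.Icc (-√3 : ℝ) √3) := by
  rw [spinLaw, map_comap_subtype_coe measurableSet_Icc, ProbabilityTheory.cond,
    Measure.restrict_smul, Measure.restrict_restrict measurableSet_Icc, Set.inter_self]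

instance isProbabilityMeasure_cond_Icc :
    IsProbabilityMeasure (ProbabilityTheory.cond volume (Set.Icc (-√3 : ℝ) √3)) :=
  cond_isProbabilityMeasure_of_finite volume_Icc_sqrt_three_ne_zero (by simp)

instance isProbabilityMeasure_spinLaw : IsProbabilityMeasure spinLaw := by
  constructor
  have := congrArg (fun m => m Set.univ) map_val_spinLaw
  simpa [Measure.map_apply measurable_subtype_coe MeasurableSet.univ] using this

lemma integral_spinLaw (f : ℝ → ℝ) (hf : Measurable f) :
    ∫ s : Spin, f s ∂spinLaw = (2 * √3)⁻¹ * ∫ x in (-√3)..√3, f x := by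
  rw [← integral_map (φ := (Subtype.val : Spin → ℝ)) (f := f) (by fun_prop)
    hf.aestronglyMeasurable, map_val_spinLaw, ProbabilityTheory.cond, integral_smul_measure,
    volume_Icc_sqrt_three, intervalIntegral.integral_of_le (by linarith [Real.sqrt_nonneg 3]),
    integral_Icc_eq_integral_Ioc]
  simp

lemma integral_spin : ∫ s : Spin, (s : ℝ) ∂spinLaw = 0 := by
  rw [integral_spinLaw (fun x => x) measurable_id]; simp

lemma integral_spin_sq : ∫ s : Spin, (s : ℝ) ^ 2 ∂spinLaw = 1 := by
  rw [integral_spinLaw (fun x => x ^ 2) (by fun_prop), integral_pow]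
  have h : √3 ^ 2 = (3 : ℝ) := Real.sq_sqrt (by norm_num)
  have h0 : √3 ≠ (0 : ℝ) := by positivity
  have h3 : √3 ^ 3 = 3 * √3 := by rw [pow_succ, h]
  have h4 : (-√3) ^ 3 = -(3 * √3) := by rw [← h3]; ring
  norm_num [h3, h4]
  field_simp
  norm_num

lemma measurePreserving_flip : MeasurePreserving Spin.flip spinLaw spinLaw := by
  refine ⟨Spin.measurable_flip, ?_⟩
  have hinj : MeasurableEmbedding (Subtype.val : Spin → ℝ) :=
    MeasurableEmbedding.subtype_coe measurableSet_Icc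
  have h1 : (spinLaw.map Spin.flip).map (Subtype.val : Spin → ℝ)
      = spinLaw.map (Subtype.val : Spin → ℝ) := by
    rw [Measure.map_map measurable_subtype_coe Spin.measurable_flip]
    have : (Subtype.val : Spin → ℝ) ∘ Spin.flip = (fun x : ℝ => -x) ∘ (Subtype.val : Spin → ℝ) := by
      ext s; simp
    rw [this, ← Measure.map_map measurable_neg measurable_subtype_coe, map_val_spinLaw]
    ext A hA
    rw [Measure.map_apply measurable_neg hA, cond_apply measurableSet_Icc,
      cond_apply measurableSet_Icc]
    congr 1
    have : Set.Icc (-√3 : ℝ) √3 ∩ (fun x => -x) ⁻¹' A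
        = (fun x : ℝ => -x) ⁻¹' (Set.Icc (-√3 : ℝ) √3 ∩ A) := by
      ext x; simp only [Set.mem_inter_iff, Set.mem_Icc, Set.mem_preimage]
      constructor <;> rintro ⟨⟨a, b⟩, c⟩ <;> exact ⟨⟨by linarith, by linarith⟩, c⟩
    rw [this]
    exact (Measure.measurePreserving_neg (volume : Measure ℝ)).measure_preimage
      (measurableSet_Icc.inter hA).nullMeasurableSet
  have := congrArg (Measure.comap (Subtype.val : Spin → ℝ)) h1
  rwa [hinj.comap_map, hinj.comap_map] at this

/-! ### I.i.d. configurations, signs and linear forms. -/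

/-- Two-sided sequences of states. -/
abbrev Config : Type := ℤ → Spin

/-- The law of an i.i.d. sequence of uniform states. -/
noncomputable def iidLaw : Measure Config := Measure.infinitePi fun _ : ℤ => spinLaw

instance isProbabilityMeasure_iidLaw : IsProbabilityMeasure iidLaw := by
  unfold iidLaw; infer_instance

/-- Change of sign of all coordinates. -/
def Config.flip (x : Config) : Config := fun k => (x k).flip

lemma Config.measurable_flip : Measurable Config.flip :=
  measurable_pi_lambda _ fun k => Spin.measurable_flip.comp (measurable_pi_apply k)

lemma measurePreserving_flip_iidLaw : MeasurePreserving Config.flip iidLaw iidLaw := by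
  refine ⟨Config.measurable_flip, ?_⟩
  unfold iidLaw Config.flip
  rw [Measure.infinitePi_map_pi (μ := fun _ : ℤ => spinLaw) (f := fun _ => Spin.flip)
    (fun _ => Spin.measurable_flip)]
  simp only [measurePreserving_flip.map_eq]

/-- The normalized sign `s / |s|`, with value `0` at `0`. -/
noncomputable def sgn (s : ℝ) : ℝ := s / |s|

lemma measurable_sgn : Measurable sgn := by unfold sgn; fun_prop

lemma sgn_neg (s : ℝ) : sgn (-s) = -sgn s := by simp [sgn, neg_div]

lemma abs_sgn_le (s : ℝ) : |sgn s| ≤ 1 := by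
  unfold sgn; rw [abs_div, abs_abs]; exact div_self_le_one _

lemma mul_sgn (s : ℝ) : s * sgn s = |s| := by
  unfold sgn
  rcases eq_or_ne s 0 with rfl | h
  · simp
  · have : |s| ≠ 0 := abs_ne_zero.2 h
    field_simp
    exact (sq_abs s).symm

/-- The linear form `∑_{k < m} w_k x_k` of the coordinates. -/
noncomputable def linForm (m : ℕ) (w : ℤ → ℝ) (x : Config) : ℝ :=
  ∑ k ∈ Finset.range m, w k * (x k : ℝ)

lemma measurable_linForm (m : ℕ) (w : ℤ → ℝ) : Measurable (linForm m w) := by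
  unfold linForm; fun_prop

lemma linForm_flip (m : ℕ) (w : ℤ → ℝ) (x : Config) : linForm m w x.flip = -linForm m w x := by
  simp [linForm, Config.flip]

lemma abs_linForm_le (m : ℕ) (w : ℤ → ℝ) (x : Config) :
    |linForm m w x| ≤ ∑ k ∈ Finset.range m, |w k| * √3 := by
  refine (Finset.abs_sum_le_sum_abs _ _).trans (Finset.sum_le_sum fun k _ => ?_)
  rw [abs_mul]
  exact mul_le_mul_of_nonneg_left (Spin.abs_coe_le _) (abs_nonneg _)

lemma sum_range_mul (a b : ℕ) (f : ℕ → ℝ) :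
    ∑ k ∈ Finset.range (a * b), f k = ∑ i : Fin a, ∑ r ∈ Finset.range b, f (i * b + r) := by
  rw [← Fin.sum_univ_eq_sum_range, ← (finProdFinEquiv (m := a) (n := b)).sum_comp,
    Fintype.sum_prod_type]
  refine Finset.sum_congr rfl fun i _ => ?_
  rw [← Fin.sum_univ_eq_sum_range (fun r => f (i * b + r))]
  refine Finset.sum_congr rfl fun r _ => ?_
  congr 1
  simp [finProdFinEquiv, add_comm, mul_comm]

/-! ### Concatenation and the hierarchical laws. -/

section concat

variable (L : ℕ)

/-- The sum of the coordinates in the block `[0, L ^ J)`. -/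
noncomputable abbrev blockSum (J : ℕ) : Config → ℝ := linForm (L ^ J) 1

/-- The product of the signs of the block sums. -/
noncomputable def signProd (J : ℕ) (x : Fin L → Config) : ℝ := ∏ i, sgn (blockSum L J (x i))

lemma measurable_signProd (J : ℕ) : Measurable (signProd L J) := by
  unfold signProd
  exact Finset.measurable_prod _ fun i _ => measurable_sgn.comp
    ((measurable_linForm _ _).comp (measurable_pi_apply i))

lemma abs_signProd_le (J : ℕ) (x : Fin L → Config) : |signProd L J x| ≤ 1 := by
  unfold signProd
  rw [Finset.abs_prod]
  exact Finset.prod_le_one (fun _ _ => abs_nonneg _) fun _ _ => abs_sgn_le _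

/-- This is the place where evenness of `L` matters: the `L` sign changes cancel. -/
lemma signProd_flip (hL : Even L) (J : ℕ) (x : Fin L → Config) :
    signProd L J (fun i => (x i).flip) = signProd L J x := by
  simp [signProd, linForm_flip, sgn_neg, Finset.prod_neg, hL.neg_one_pow]

variable [NeZero L]

/-- The index of the block of length `L ^ J` to which the position `k` is assigned; positions
outside `[0, L ^ (J + 1))` are assigned to the first or the last block. -/
def blockIndex (J : ℕ) (k : ℤ) : Fin L :=
  ⟨min (k / (L : ℤ) ^ J).toNat (L - 1),
    lt_of_le_of_lt (min_le_right _ _) (Nat.sub_lt (Nat.pos_of_ne_zero (NeZero.ne L)) one_pos)⟩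

/-- The position of `k` relative to the start of its block. -/
def blockOffset (J : ℕ) (k : ℤ) : ℤ := k - (blockIndex L J k : ℕ) * (L : ℤ) ^ J

/-- Concatenation of `L` configurations along consecutive blocks of length `L ^ J`. -/
def concat (J : ℕ) (x : Fin L → Config) : Config :=
  fun k => x (blockIndex L J k) (blockOffset L J k)

lemma measurable_concat (J : ℕ) : Measurable (concat L J) :=
  measurable_pi_lambda _ fun _ => (measurable_pi_apply _).comp (measurable_pi_apply _)

lemma blockIndex_add (J : ℕ) (i : Fin L) (r : ℕ) (hr : r < L ^ J) :
    blockIndex L J (((i : ℕ) : ℤ) * (L : ℤ) ^ J + r) = i := by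
  have hL : (0 : ℤ) < (L : ℤ) ^ J := by
    have := Nat.pos_of_ne_zero (NeZero.ne L)
    positivity
  have : (((i : ℕ) : ℤ) * (L : ℤ) ^ J + r) / (L : ℤ) ^ J = (i : ℕ) := by
    rw [add_comm, Int.add_mul_ediv_right _ _ hL.ne', Int.ediv_eq_zero_of_lt (by positivity)
      (by exact_mod_cast hr), zero_add]
  ext
  simp only [blockIndex, this, Int.toNat_natCast]
  have := i.2
  omega

lemma concat_add (J : ℕ) (x : Fin L → Config) (i : Fin L) (r : ℕ) (hr : r < L ^ J) :
    concat L J x (((i : ℕ) : ℤ) * (L : ℤ) ^ J + r) = x i r := by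
  unfold concat blockOffset
  rw [blockIndex_add L J i r hr]
  congr 1; ring

/-- The weights induced on the `i`-th block. -/
def childWeight (J : ℕ) (w : ℤ → ℝ) (i : Fin L) (k : ℤ) : ℝ :=
  w (((i : ℕ) : ℤ) * (L : ℤ) ^ J + k)

lemma linForm_concat (J : ℕ) (w : ℤ → ℝ) (x : Fin L → Config) :
    linForm (L ^ (J + 1)) w (concat L J x) =
      ∑ i, linForm (L ^ J) (childWeight L J w i) (x i) := by
  unfold linForm
  rw [pow_succ', sum_range_mul]
  refine Finset.sum_congr rfl fun i _ => Finset.sum_congr rfl fun r hr => ?_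
  have := concat_add L J x i r (Finset.mem_range.1 hr)
  push_cast
  rw [this]
  rfl

/-- The hierarchical laws: a block of level `J + 1` is the concatenation of `L` blocks of level `J`,
reweighted according to the product of the signs of their sums. -/
noncomputable def blockLaw : ℕ → Measure Config
  | 0 => iidLaw
  | J + 1 => ((Measure.pi fun _ : Fin L => blockLaw J).withDensity
      fun x => ENNReal.ofReal (1 + signProd L J x)).map (concat L J)

end concat

/-! ### Bounded measurable functions and sign symmetry. -/

/-- Bounded measurable real functions. -/
structure BddMeasurable {α : Type*} [MeasurableSpace α] (f : α → ℝ) : Prop where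
  measurable : Measurable f
  bdd : ∃ C, ∀ x, |f x| ≤ C

namespace BddMeasurable

variable {α β ι : Type*} [MeasurableSpace α] [MeasurableSpace β] {f g : α → ℝ}

lemma integrable (hf : BddMeasurable f) (μ : Measure α) [IsFiniteMeasure μ] : Integrable f μ := by
  obtain ⟨C, hC⟩ := hf.bdd
  exact Integrable.of_bound hf.measurable.aestronglyMeasurable C
    (Eventually.of_forall fun x => by simpa using hC x)

lemma const (c : ℝ) : BddMeasurable fun _ : α => c := ⟨measurable_const, |c|, fun _ => le_rfl⟩

lemma mul (hf : BddMeasurable f) (hg : BddMeasurable g) : BddMeasurable fun x => f x * g x := by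
  obtain ⟨C, hC⟩ := hf.bdd
  obtain ⟨D, hD⟩ := hg.bdd
  refine ⟨hf.measurable.mul hg.measurable, C * D, fun x => ?_⟩
  rw [abs_mul]
  exact mul_le_mul (hC x) (hD x) (abs_nonneg _) ((abs_nonneg _).trans (hC x))

lemma add (hf : BddMeasurable f) (hg : BddMeasurable g) : BddMeasurable fun x => f x + g x := by
  obtain ⟨C, hC⟩ := hf.bdd
  obtain ⟨D, hD⟩ := hg.bdd
  exact ⟨hf.measurable.add hg.measurable, C + D, fun x =>
    (abs_add_le _ _).trans (add_le_add (hC x) (hD x))⟩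

lemma comp (hf : BddMeasurable f) {φ : β → α} (hφ : Measurable φ) :
    BddMeasurable fun x => f (φ x) :=
  ⟨hf.measurable.comp hφ, hf.bdd.choose, fun _ => hf.bdd.choose_spec _⟩

lemma prod (s : Finset ι) {f : ι → α → ℝ} (hf : ∀ i ∈ s, BddMeasurable (f i)) :
    BddMeasurable fun x => ∏ i ∈ s, f i x := by
  classical
  induction s using Finset.induction_on with
  | empty => simpa using const 1
  | insert a s ha ih =>
    simp only [Finset.prod_insert ha]
    exact (hf a (Finset.mem_insert_self _ _)).mul
      (ih fun i hi => hf i (Finset.mem_insert_of_mem hi))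

lemma sum (s : Finset ι) {f : ι → α → ℝ} (hf : ∀ i ∈ s, BddMeasurable (f i)) :
    BddMeasurable fun x => ∑ i ∈ s, f i x := by
  classical
  induction s using Finset.induction_on with
  | empty => simpa using const 0
  | insert a s ha ih =>
    simp only [Finset.sum_insert ha]
    exact (hf a (Finset.mem_insert_self _ _)).add
      (ih fun i hi => hf i (Finset.mem_insert_of_mem hi))

lemma pow (hf : BddMeasurable f) (n : ℕ) : BddMeasurable fun x => f x ^ n := by
  simpa using prod (Finset.range n) (f := fun _ => f) fun _ _ => hf

lemma continuous_comp (hf : BddMeasurable f) {φ : ℝ → ℝ} (hφ : Continuous φ) :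
    BddMeasurable fun x => φ (f x) := by
  obtain ⟨C, hC⟩ := hf.bdd
  obtain ⟨D, hD⟩ := (isCompact_Icc (a := -C) (b := C)).exists_bound_of_continuousOn hφ.continuousOn
  exact ⟨hφ.measurable.comp hf.measurable, D, fun x => hD _ (abs_le.1 (hC x))⟩

end BddMeasurable

lemma bddMeasurable_sgn : BddMeasurable sgn := ⟨measurable_sgn, 1, abs_sgn_le⟩

lemma bddMeasurable_spin : BddMeasurable fun s : Spin => (s : ℝ) :=
  ⟨measurable_subtype_coe, √3, Spin.abs_coe_le⟩

lemma bddMeasurable_coord (k : ℤ) : BddMeasurable fun x : Config => (x k : ℝ) :=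
  bddMeasurable_spin.comp (φ := fun x : Config => x k) (measurable_pi_apply k)

lemma bddMeasurable_linForm (m : ℕ) (w : ℤ → ℝ) : BddMeasurable (linForm m w) :=
  ⟨measurable_linForm m w, _, abs_linForm_le m w⟩

lemma bddMeasurable_sgn_linForm (m : ℕ) (w : ℤ → ℝ) :
    BddMeasurable fun x => sgn (linForm m w x) :=
  bddMeasurable_sgn.comp (measurable_linForm m w)

lemma integral_flip {μ : Measure Config} (h : MeasurePreserving Config.flip μ μ) (f : Config → ℝ)
    (hf : Measurable f) : ∫ x, f x.flip ∂μ = ∫ x, f x ∂μ := by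
  conv_rhs => rw [← h.map_eq]
  rw [integral_map h.measurable.aemeasurable hf.aestronglyMeasurable]

lemma integral_eq_zero_of_odd {μ : Measure Config} (h : MeasurePreserving Config.flip μ μ)
    (f : Config → ℝ) (hf : Measurable f) (hodd : ∀ x, f x.flip = -f x) : ∫ x, f x ∂μ = 0 := by
  have := integral_flip h f hf
  simp only [hodd, integral_neg] at this
  linarith

/-! ### Symmetry of the block laws and comparison with the i.i.d. law. -/

section blockLaw

variable (L : ℕ)

lemma blockSum_flip (J : ℕ) (x : Config) : blockSum L J x.flip = -blockSum L J x :=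
  linForm_flip _ _ _

lemma one_add_signProd_nonneg (J : ℕ) (x : Fin L → Config) : 0 ≤ 1 + signProd L J x := by
  linarith [(abs_le.1 (abs_signProd_le L J x)).1]

lemma bddMeasurable_signProd (J : ℕ) : BddMeasurable (signProd L J) :=
  ⟨measurable_signProd L J, 1, abs_signProd_le L J⟩

lemma bddMeasurable_density (J : ℕ) : BddMeasurable fun x => 1 + signProd L J x :=
  (BddMeasurable.const 1).add (bddMeasurable_signProd L J)

variable [NeZero L]

lemma integral_blockLaw_succ (J : ℕ) (F : Config → ℝ) (hF : Measurable F) :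
    ∫ x, F x ∂blockLaw L (J + 1) =
      ∫ x, (1 + signProd L J x) * F (concat L J x) ∂Measure.pi fun _ : Fin L => blockLaw L J := by
  rw [blockLaw, integral_map (measurable_concat L J).aemeasurable hF.aestronglyMeasurable,
    integral_withDensity_eq_integral_toReal_smul
      (bddMeasurable_density L J).measurable.ennreal_ofReal (by simp)]
  refine integral_congr_ae (Eventually.of_forall fun x => ?_)
  simp [ENNReal.toReal_ofReal (one_add_signProd_nonneg L J x)]

/-- The map from positions to pairs (block, offset) is injective on all of `ℤ`, so a concatenation
reads distinct coordinates of independent i.i.d. sequences. -/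
lemma map_concat_iidLaw (J : ℕ) :
    (Measure.pi fun _ : Fin L => iidLaw).map (concat L J) = iidLaw := by
  classical
  refine Measure.eq_infinitePi _ fun s t ht => ?_
  have hm : MeasurableSet (Set.pi (s : Set ℤ) t) := .pi s.countable_toSet fun i _ => ht i
  have hinj : ∀ i, Set.InjOn (blockOffset L J) ({k ∈ s | blockIndex L J k = i} : Finset ℤ) := by
    intro i a ha b hb hab
    simp only [Finset.coe_filter, Set.mem_ofPred_eq] at ha hb
    unfold blockOffset at hab
    rw [ha.2, hb.2] at hab
    linarith
  have hpre : concat L J ⁻¹' Set.pi (s : Set ℤ) t = Set.univ.pi fun i : Fin L =>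
      Set.pi (({k ∈ s | blockIndex L J k = i}.image (blockOffset L J) : Finset ℤ) : Set ℤ)
        fun r => t (r + (i : ℕ) * (L : ℤ) ^ J) := by
    ext x
    simp only [Set.mem_preimage, Set.mem_pi, Set.mem_univ, forall_true_left, Finset.mem_coe,
      Finset.mem_image, Finset.mem_filter, concat]
    constructor
    · rintro h i r ⟨k, ⟨hk, rfl⟩, rfl⟩
      simpa [blockOffset] using h k hk
    · intro h k hk
      simpa [blockOffset] using h (blockIndex L J k) (blockOffset L J k) ⟨k, ⟨hk, rfl⟩, rfl⟩
  rw [Measure.map_apply (measurable_concat L J) hm, hpre, Measure.pi_pi]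
  rw [← Finset.prod_fiberwise s (blockIndex L J)]
  refine Finset.prod_congr rfl fun i _ => ?_
  rw [iidLaw, Measure.infinitePi_pi _ (fun r _ => ht _), Finset.prod_image (hinj i)]
  refine Finset.prod_congr rfl fun k hk => ?_
  rw [Finset.mem_filter] at hk
  congr 2
  simp [blockOffset, hk.2]

lemma integral_iidLaw_prod (J : ℕ) (F : Config → ℝ) (hF : Measurable F)
    (f : Fin L → Config → ℝ) (h : ∀ x, F (concat L J x) = ∏ i, f i (x i)) :
    ∫ x, F x ∂iidLaw = ∏ i, ∫ x, f i x ∂iidLaw := by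
  rw [← integral_fintype_prod_eq_prod]
  conv_lhs => rw [← map_concat_iidLaw L J]
  rw [integral_map (measurable_concat L J).aemeasurable hF.aestronglyMeasurable]
  simp only [h]

variable [hL : Fact (Even L)]

/-- The two claims need a joint induction: mass one at level `J + 1` uses that the sign of a block
sum is centred, which is the flip symmetry at level `J`. -/
lemma blockLaw_prob_and_flip (J : ℕ) : IsProbabilityMeasure (blockLaw L J) ∧
    MeasurePreserving Config.flip (blockLaw L J) (blockLaw L J) := by
  induction J with
  | zero => exact ⟨isProbabilityMeasure_iidLaw, measurePreserving_flip_iidLaw⟩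
  | succ J ih =>
    obtain ⟨hp, hf⟩ := ih
    let π := Measure.pi fun _ : Fin L => blockLaw L J
    have hd := (bddMeasurable_density L J).measurable.ennreal_ofReal
    have hpi : MeasurePreserving (fun (x : Fin L → Config) i => (x i).flip) π π :=
      measurePreserving_pi _ _ fun _ => hf
    refine ⟨⟨?_⟩, Config.measurable_flip, ?_⟩
    · rw [blockLaw, Measure.map_apply (measurable_concat L J) .univ, Set.preimage_univ,
        withDensity_apply _ .univ, Measure.restrict_univ, ← ofReal_integral_eq_lintegral_ofReal
          ((bddMeasurable_density L J).integrable _)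
          (Eventually.of_forall (one_add_signProd_nonneg L J)),
        integral_add (integrable_const _) ((bddMeasurable_signProd L J).integrable _)]
      have : ∫ x, signProd L J x ∂Measure.pi (fun _ : Fin L => blockLaw L J) = 0 := by
        unfold signProd
        rw [integral_fintype_prod_eq_prod (fun _ : Fin L => fun y => sgn (blockSum L J y))]
        refine Finset.prod_eq_zero (Finset.mem_univ 0) ?_
        exact integral_eq_zero_of_odd hf _ (bddMeasurable_sgn_linForm _ _).measurable
          fun x => by rw [blockSum_flip, sgn_neg]
      rw [this]; simp
    · have hwd : (π.withDensity fun x => ENNReal.ofReal (1 + signProd L J x)).map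
          (fun (x : Fin L → Config) i => (x i).flip) =
          π.withDensity fun x => ENNReal.ofReal (1 + signProd L J x) := by
        ext A hA
        rw [Measure.map_apply hpi.measurable hA, withDensity_apply _ (hpi.measurable hA),
          withDensity_apply _ hA, ← hpi.setLIntegral_comp_preimage hA hd]
        simp only [signProd_flip L hL.out]
      rw [blockLaw, Measure.map_map Config.measurable_flip (measurable_concat L J)]
      conv_rhs => rw [← hwd, Measure.map_map (measurable_concat L J) hpi.measurable]
      rfl

instance isProbabilityMeasure_blockLaw (J : ℕ) : IsProbabilityMeasure (blockLaw L J) :=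
  (blockLaw_prob_and_flip L J).1

lemma measurePreserving_flip_blockLaw (J : ℕ) :
    MeasurePreserving Config.flip (blockLaw L J) (blockLaw L J) :=
  (blockLaw_prob_and_flip L J).2

/-- The basic recursion: the summand `1` of the density gives independent blocks, and the sign
product attaches one sign to each block. -/
lemma integral_blockLaw_succ_prod (J : ℕ) (F : Config → ℝ) (hF : Measurable F)
    (f : Fin L → Config → ℝ) (hf : ∀ i, BddMeasurable (f i))
    (h : ∀ x, F (concat L J x) = ∏ i, f i (x i)) :
    ∫ x, F x ∂blockLaw L (J + 1) = ∏ i, ∫ x, f i x ∂blockLaw L J +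
      ∏ i, ∫ x, f i x * sgn (blockSum L J x) ∂blockLaw L J := by
  rw [integral_blockLaw_succ L J F hF, ← integral_fintype_prod_eq_prod,
    ← integral_fintype_prod_eq_prod, ← integral_add]
  · refine integral_congr_ae (Eventually.of_forall fun x => ?_)
    simp only [h, Finset.prod_mul_distrib, signProd]
    ring
  · exact (BddMeasurable.prod _ fun i _ => (hf i).comp (measurable_pi_apply i)).integrable _
  · exact (BddMeasurable.prod _ fun i _ => ((hf i).mul
      (bddMeasurable_sgn_linForm _ _)).comp (measurable_pi_apply i)).integrable _

lemma integral_sgn_blockSum_of_even (J : ℕ) (f : Config → ℝ) (hf : Measurable f)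
    (he : ∀ x, f x.flip = f x) : ∫ x, f x * sgn (blockSum L J x) ∂blockLaw L J = 0 :=
  integral_eq_zero_of_odd (measurePreserving_flip_blockLaw L J) _
    (hf.mul (bddMeasurable_sgn_linForm _ _).measurable)
    fun x => by rw [he, blockSum_flip, sgn_neg, mul_neg]

/-- Products of fewer than `L` functions of one coordinate, and products of even functions of one
coordinate, have the same expectation under the hierarchical laws as in the i.i.d. case. -/
lemma integral_blockLaw_prod_eq {α : Type*} (J : ℕ) (A : Finset α) (g : α → Spin → ℝ)
    (hg : ∀ a, BddMeasurable (g a)) (τ : α → ℤ)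
    (h : A.card < L ∨ ∀ a ∈ A, ∀ s, g a s.flip = g a s) :
    ∫ x, ∏ a ∈ A, g a (x (τ a)) ∂blockLaw L J = ∫ x, ∏ a ∈ A, g a (x (τ a)) ∂iidLaw := by
  classical
  induction J generalizing A τ with
  | zero => rfl
  | succ J ih =>
    have hm : ∀ (B : Finset α) (σ : α → ℤ),
        BddMeasurable fun x : Config => ∏ a ∈ B, g a (x (σ a)) := fun B σ =>
      BddMeasurable.prod _ fun a _ => (hg a).comp (measurable_pi_apply _)
    set B : Fin L → Finset α := fun i => {a ∈ A | blockIndex L J (τ a) = i} with hB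
    have hdec : ∀ x, ∏ a ∈ A, g a (concat L J x (τ a)) =
        ∏ i, ∏ a ∈ B i, g a (x i (blockOffset L J (τ a))) := by
      intro x
      rw [← Finset.prod_fiberwise A (fun a => blockIndex L J (τ a))]
      refine Finset.prod_congr rfl fun i _ => Finset.prod_congr rfl fun a ha => ?_
      rw [hB, Finset.mem_filter] at ha
      rw [concat, ha.2]
    rw [integral_blockLaw_succ_prod L J _ (hm A τ).measurable _ (fun i => hm (B i) _) hdec,
      integral_iidLaw_prod L J _ (hm A τ).measurable
        (fun i x => ∏ a ∈ B i, g a (x (blockOffset L J (τ a)))) hdec]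
    have hsub : ∀ i, B i ⊆ A := fun i => Finset.filter_subset _ _
    -- Some block carries only even functions. With fewer than `L` functions, pigeonhole leaves a
    -- block empty, and the empty product is even.
    have hz : ∃ i, ∀ a ∈ B i, ∀ s, g a s.flip = g a s := by
      rcases h with h | h
      · have : ∃ i, B i = ∅ := by
          by_contra! hne
          have hcard : L ≤ A.card := by
            calc L = (Finset.univ : Finset (Fin L)).card := by simp
              _ ≤ (A.image fun a => blockIndex L J (τ a)).card := by
                refine Finset.card_le_card fun i _ => ?_
                obtain ⟨a, ha⟩ := hne i
                rw [hB, Finset.mem_filter] at ha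
                exact Finset.mem_image.2 ⟨a, ha.1, ha.2⟩
              _ ≤ A.card := Finset.card_image_le
          omega
        obtain ⟨i, hi⟩ := this
        exact ⟨i, by simp [hi]⟩
      · exact ⟨0, fun a ha => h a (hsub 0 ha)⟩
    obtain ⟨i, hi⟩ := hz
    -- In that block an even function is multiplied by an odd sign, so the whole correction
    -- vanishes.
    have hzero : ∏ i, ∫ x : Config, (∏ a ∈ B i, g a (x (blockOffset L J (τ a)))) *
        sgn (blockSum L J x) ∂blockLaw L J = 0 := by
      refine Finset.prod_eq_zero (Finset.mem_univ i) ?_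
      refine integral_sgn_blockSum_of_even L J _ (hm _ _).measurable fun x => ?_
      exact Finset.prod_congr rfl fun a ha => hi a ha _
    rw [hzero, add_zero]
    refine Finset.prod_congr rfl fun i _ => ih (B i) _ ?_
    exact h.imp (fun h => (Finset.card_le_card (hsub i)).trans_lt h)
      fun h a ha => h a (hsub i ha)

end blockLaw

/-! ### The exponential moment bound, uniform in the level. -/

/-- Let `a` and `b` be the means of `exp |T|` and `exp (-|T|)`, and let `M` and `K` be the two
integrals in the statement. By symmetry `2 M = a + b` and `|2 K| ≤ a - b`, so `K² ≤ M² - a b`, and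
`a b ≥ 1`. -/
lemma sq_integral_exp_mul_odd_le {μ : Measure Config} [IsProbabilityMeasure μ]
    (h : MeasurePreserving Config.flip μ μ) {T σ : Config → ℝ} (hT : BddMeasurable T)
    (hσ : BddMeasurable σ) (hT' : ∀ x, T x.flip = -T x) (hσ' : ∀ x, σ x.flip = -σ x)
    (hσ1 : ∀ x, |σ x| ≤ 1) :
    (∫ x, Real.exp (T x) * σ x ∂μ) ^ 2 ≤ (∫ x, Real.exp (T x) ∂μ) ^ 2 - 1 := by
  have b1 : BddMeasurable fun x => Real.exp (T x) := hT.continuous_comp Real.continuous_exp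
  have b2 : BddMeasurable fun x => Real.exp (-T x) :=
    hT.continuous_comp (φ := fun t => Real.exp (-t)) (by fun_prop)
  have b3 : BddMeasurable fun x => Real.exp |T x| :=
    hT.continuous_comp (φ := fun t => Real.exp |t|) (by fun_prop)
  have b4 : BddMeasurable fun x => Real.exp (-|T x|) :=
    hT.continuous_comp (φ := fun t => Real.exp (-|t|)) (by fun_prop)
  set a := ∫ x, Real.exp |T x| ∂μ with ha
  set b := ∫ x, Real.exp (-|T x|) ∂μ with hb
  have hM : 2 * ∫ x, Real.exp (T x) ∂μ = a + b := by
    have h1 : ∫ x, Real.exp (T x) ∂μ = ∫ x, Real.exp (-T x) ∂μ := by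
      rw [← integral_flip h _ b1.measurable]; simp only [hT']
    rw [ha, hb, ← integral_add (b3.integrable μ) (b4.integrable μ), two_mul]
    nth_rw 2 [h1]
    rw [← integral_add (b1.integrable μ) (b2.integrable μ)]
    congr 1; ext x
    rcases abs_choice (T x) with h | h <;> rw [h]
    rw [neg_neg, add_comm]
  have hK : 2 * ∫ x, Real.exp (T x) * σ x ∂μ =
      ∫ x, (Real.exp (T x) - Real.exp (-T x)) * σ x ∂μ := by
    have h1 : ∫ x, Real.exp (T x) * σ x ∂μ = -∫ x, Real.exp (-T x) * σ x ∂μ := by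
      rw [← integral_flip h _ (b1.mul hσ).measurable, ← integral_neg]
      simp only [hT', hσ', mul_neg]
    simp only [sub_mul]
    rw [integral_sub ((b1.mul hσ).integrable μ) ((b2.mul hσ).integrable μ)]
    linarith
  have hKle : |2 * ∫ x, Real.exp (T x) * σ x ∂μ| ≤ a - b := by
    rw [hK, ha, hb, ← integral_sub (b3.integrable μ) (b4.integrable μ), ← Real.norm_eq_abs]
    refine norm_integral_le_of_norm_le ((b3.integrable μ).sub (b4.integrable μ))
      (Eventually.of_forall fun x => ?_)
    rw [Real.norm_eq_abs, abs_mul]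
    refine (mul_le_of_le_one_right (abs_nonneg _) (hσ1 x)).trans (le_of_eq ?_)
    rcases le_total 0 (T x) with h | h
    · rw [abs_of_nonneg h, abs_of_nonneg]
      exact sub_nonneg.2 (Real.exp_le_exp.2 (by linarith))
    · rw [abs_of_nonpos h, neg_neg, abs_of_nonpos, neg_sub]
      exact sub_nonpos.2 (Real.exp_le_exp.2 (by linarith))
  have ha1 : 1 ≤ a := by
    have : ∫ _ : Config, (1 : ℝ) ∂μ ≤ a :=
      integral_mono (integrable_const _) (b3.integrable μ)
        fun x => Real.one_le_exp (abs_nonneg (T x))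
    simpa using this
  -- Jensen for `t ↦ 1 / t` in tangent-line form at `t = a`, where `t = exp |T|`.
  have hab : 1 ≤ a * b := by
    have : ∫ x, (2 * a⁻¹ - a⁻¹ ^ 2 * Real.exp |T x|) ∂μ ≤ b := by
      refine integral_mono ((integrable_const _).sub ((b3.integrable μ).const_mul _))
        (b4.integrable μ) fun x => ?_
      have hp := Real.exp_pos |T x|
      simp only [Real.exp_neg]
      have : 0 ≤ (a⁻¹ * Real.exp |T x| - 1) ^ 2 * (Real.exp |T x|)⁻¹ := by positivity
      have e : (a⁻¹ * Real.exp |T x| - 1) ^ 2 * (Real.exp |T x|)⁻¹ =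
        a⁻¹ ^ 2 * Real.exp |T x| - 2 * a⁻¹ + (Real.exp |T x|)⁻¹ := by
        field_simp; ring
      linarith
    rw [integral_sub (integrable_const _) ((b3.integrable μ).const_mul _),
      integral_const_mul (a⁻¹ ^ 2), ← ha] at this
    have h3 : a * (2 * a⁻¹ - a⁻¹ ^ 2 * a) = 1 := by field_simp; norm_num
    simp only [integral_const, probReal_univ, smul_eq_mul, one_mul] at this
    calc 1 = a * (2 * a⁻¹ - a⁻¹ ^ 2 * a) := h3.symm
      _ ≤ a * b := by gcongr
  have h5 := sq_le_sq.2 (hKle.trans (le_abs_self _))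
  have h6 := congrArg (· ^ 2) hM
  linarith [mul_pow 2 (∫ x, Real.exp (T x) * σ x ∂μ) 2, mul_pow 2 (∫ x, Real.exp (T x) ∂μ) 2,
    sub_sq a b, add_sq a b]

/-- Four factors suffice, which is why `4 ≤ L`: by the inequality of arithmetic and geometric means
their product is at most `(27/8)² / 2 * (u_a u_b + u_c u_d)`, while `2 (u_a u_b + u_c u_d)` is part
of the off-diagonal sum `U² - ∑ u_i²`. The constant `3` exceeds `(27/8)² / 4`. -/
lemma prod_le_of_sq_le {L : ℕ} (hL : 4 ≤ L) (y u : Fin L → ℝ) (hy : ∀ i, 0 ≤ y i)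
    (hy1 : ∀ i, y i ≤ 1) (hyu : ∀ i, y i ^ 2 ≤ 27 / 8 * u i) :
    ∏ i, y i ≤ 3 * ((∑ i, u i) ^ 2 - ∑ i, u i ^ 2) := by
  have hu : ∀ i, 0 ≤ u i := fun i => by nlinarith [hyu i, sq_nonneg (y i)]
  set U := ∑ i, u i with hU
  have hpair : ∀ i j, i ≠ j → u i + u j ≤ U := fun i j hij => by
    rw [← Finset.sum_pair hij]
    exact Finset.sum_le_sum_of_subset_of_nonneg (Finset.subset_univ _) fun i _ _ => hu i
  have hterm : ∀ i, 0 ≤ u i * (U - u i) := fun i =>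
    mul_nonneg (hu i) (sub_nonneg.2 (Finset.single_le_sum (fun i _ => hu i) (Finset.mem_univ i)))
  let a : Fin L := ⟨0, by omega⟩
  let b : Fin L := ⟨1, by omega⟩
  let c : Fin L := ⟨2, by omega⟩
  let d : Fin L := ⟨3, by omega⟩
  have hab : a ≠ b := by simp [a, b]
  have hac : a ≠ c := by simp [a, c]
  have had : a ≠ d := by simp [a, d]
  have hbc : b ≠ c := by simp [b, c]
  have hbd : b ≠ d := by simp [b, d]
  have hcd : c ≠ d := by simp [c, d]
  have hsum : ∀ f : Fin L → ℝ, ∑ i ∈ ({a, b, c, d} : Finset (Fin L)), f i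
      = f a + f b + f c + f d := fun f => by
    rw [Finset.sum_insert (by simp [hab, hac, had]), Finset.sum_insert (by simp [hbc, hbd]),
      Finset.sum_pair hcd]; ring
  have hprod : ∏ i ∈ ({a, b, c, d} : Finset (Fin L)), y i = y a * y b * (y c * y d) := by
    rw [Finset.prod_insert (by simp [hab, hac, had]), Finset.prod_insert (by simp [hbc, hbd]),
      Finset.prod_pair hcd]; ring
  have h1 : ∏ i, y i ≤ y a * y b * (y c * y d) := by
    rw [← hprod, ← Finset.prod_sdiff (Finset.subset_univ ({a, b, c, d} : Finset (Fin L)))]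
    exact mul_le_of_le_one_left (Finset.prod_nonneg fun i _ => hy i)
      (Finset.prod_le_one (fun i _ => hy i) fun i _ => hy1 i)
  have h2 : u a * u b * 2 + u c * u d * 2 ≤ U ^ 2 - ∑ i, u i ^ 2 := by
    have e : U ^ 2 - ∑ i, u i ^ 2 = ∑ i, u i * (U - u i) := by
      simp only [mul_sub, Finset.sum_sub_distrib, ← Finset.sum_mul, ← hU]
      simp only [pow_two]
    have h3 : u a * (U - u a) + u b * (U - u b) + u c * (U - u c) + u d * (U - u d) ≤
        ∑ i, u i * (U - u i) := by
      rw [← hsum fun i => u i * (U - u i)]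
      exact Finset.sum_le_sum_of_subset_of_nonneg (Finset.subset_univ _) fun i _ _ => hterm i
    rw [e]
    refine le_trans ?_ h3
    nlinarith [mul_le_mul_of_nonneg_left (hpair a b hab) (hu a),
      mul_le_mul_of_nonneg_left (hpair a b hab) (hu b),
      mul_le_mul_of_nonneg_left (hpair c d hcd) (hu c),
      mul_le_mul_of_nonneg_left (hpair c d hcd) (hu d)]
  have h4 : ∀ i j, (y i * y j) ^ 2 ≤ (27 / 8) ^ 2 * (u i * u j) := fun i j => by
    rw [mul_pow]
    calc y i ^ 2 * y j ^ 2 ≤ (27 / 8 * u i) * (27 / 8 * u j) :=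
          mul_le_mul (hyu i) (hyu j) (sq_nonneg _) ((sq_nonneg _).trans (hyu i))
      _ = _ := by ring
  nlinarith [h4 a b, h4 c d, sq_nonneg (y a * y b - y c * y d), mul_nonneg (hu a) (hu b),
    mul_nonneg (hu c) (hu d)]

/-- The inductive step of the exponential bound. The quadratic term in the exponent is
superadditive, with slack `3 (U² - ∑ u_i²)`; this slack absorbs the correction `∏ K i`, which is
small because `K i ^ 2 ≤ exp (2 h i) * (2 h i)`. -/
lemma sum_prod_exp_le {L : ℕ} (hL : 4 ≤ L) (u M K : Fin L → ℝ) (hu : ∀ i, 0 ≤ u i)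
    (hU : ∑ i, u i ≤ 1 / 16) (hM0 : ∀ i, 0 ≤ M i)
    (hM : ∀ i, M i ≤ Real.exp (3 / 2 * u i + 3 * u i ^ 2))
    (hK : ∀ i, K i ^ 2 ≤ M i ^ 2 - 1) :
    ∏ i, M i + ∏ i, K i ≤ Real.exp (3 / 2 * ∑ i, u i + 3 * (∑ i, u i) ^ 2) := by
  set h : Fin L → ℝ := fun i => 3 / 2 * u i + 3 * u i ^ 2 with hh
  have hu16 : ∀ i, u i ≤ 1 / 16 := fun i =>
    (Finset.single_le_sum (fun i _ => hu i) (Finset.mem_univ i)).trans hU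
  have hh0 : ∀ i, 0 ≤ h i := fun i => by have := hu i; simp only [hh]; positivity
  -- From `u i ≤ 1/16`: `2 h i = 3 u i + 6 (u i)² ≤ (3 + 6/16) u i`.
  have hyu : ∀ i, √(2 * h i) ^ 2 ≤ 27 / 8 * u i := fun i => by
    rw [Real.sq_sqrt (by have := hh0 i; positivity)]
    simp only [hh]; nlinarith [hu i, hu16 i]
  have hy1 : ∀ i, √(2 * h i) ≤ 1 := fun i => by
    have h1 := hyu i
    have h2 := hu16 i
    nlinarith [Real.sqrt_nonneg (2 * h i)]
  have hKle : ∀ i, |K i| ≤ Real.exp (h i) * √(2 * h i) := fun i => by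
    refine abs_le_of_sq_le_sq ?_ (by positivity)
    rw [mul_pow, Real.sq_sqrt (by have := hh0 i; positivity)]
    have h1 : M i ^ 2 ≤ Real.exp (h i) ^ 2 := pow_le_pow_left₀ (hM0 i) (hM i) 2
    have h2 : 1 - 2 * h i ≤ Real.exp (-(2 * h i)) := by
      linarith [Real.add_one_le_exp (-(2 * h i))]
    have h3 : Real.exp (h i) ^ 2 * Real.exp (-(2 * h i)) = 1 := by
      rw [← Real.exp_nat_mul, ← Real.exp_add]; simp
    have h4 : 0 < Real.exp (h i) ^ 2 := by positivity
    nlinarith [hK i, mul_le_mul_of_nonneg_left h2 h4.le]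
  have hMle : ∏ i, M i ≤ Real.exp (∑ i, h i) := by
    rw [Real.exp_sum]
    exact Finset.prod_le_prod (fun i _ => hM0 i) fun i _ => hM i
  have hKp : ∏ i, K i ≤ Real.exp (∑ i, h i) * ∏ i, √(2 * h i) := by
    rw [Real.exp_sum, ← Finset.prod_mul_distrib]
    refine (le_abs_self _).trans ?_
    rw [Finset.abs_prod]
    exact Finset.prod_le_prod (fun i _ => abs_nonneg _) fun i _ => hKle i
  have hp := prod_le_of_sq_le hL (fun i => √(2 * h i)) u (fun i => Real.sqrt_nonneg _) hy1 hyu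
  have hsum : 3 / 2 * ∑ i, u i + 3 * (∑ i, u i) ^ 2 =
      ∑ i, h i + 3 * ((∑ i, u i) ^ 2 - ∑ i, u i ^ 2) := by
    simp only [hh, Finset.sum_add_distrib, ← Finset.mul_sum]; ring
  rw [hsum, Real.exp_add]
  calc ∏ i, M i + ∏ i, K i ≤ Real.exp (∑ i, h i) * (∏ i, √(2 * h i) + 1) := by
        rw [mul_add, mul_one]; linarith
    _ ≤ _ := by
      gcongr
      exact (add_le_add_left hp 1).trans (Real.add_one_le_exp _)

lemma exp_linForm_concat (L : ℕ) [NeZero L] (J : ℕ) (w : ℤ → ℝ) (x : Fin L → Config) :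
    Real.exp (linForm (L ^ (J + 1)) w (concat L J x)) =
      ∏ i, Real.exp (linForm (L ^ J) (childWeight L J w i) (x i)) := by
  rw [linForm_concat, Real.exp_sum]

lemma bddMeasurable_exp_linForm (m : ℕ) (w : ℤ → ℝ) :
    BddMeasurable fun x => Real.exp (linForm m w x) :=
  (bddMeasurable_linForm m w).continuous_comp Real.continuous_exp

lemma sum_childWeight (L : ℕ) [NeZero L] (J : ℕ) (f : ℝ → ℝ) (w : ℤ → ℝ) :
    ∑ k ∈ Finset.range (L ^ (J + 1)), f (w k) =
      ∑ i : Fin L, ∑ k ∈ Finset.range (L ^ J), f (childWeight L J w i k) := by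
  rw [pow_succ', sum_range_mul]
  simp [childWeight]

/-- Symmetry replaces `exp` by `cosh`, then `cosh t ≤ exp (t² / 2)` and `x² ≤ 3`. -/
lemma integral_exp_coord_le {μ : Measure Config} [IsProbabilityMeasure μ]
    (h : MeasurePreserving Config.flip μ μ) (c : ℝ) (k : ℤ) :
    ∫ x, Real.exp (c * (x k : ℝ)) ∂μ ≤ Real.exp (3 / 2 * c ^ 2) := by
  have b0 : BddMeasurable fun x : Config => c * (x k : ℝ) :=
    (BddMeasurable.const c).mul (bddMeasurable_spin.comp (measurable_pi_apply k))
  have b1 : BddMeasurable fun x : Config => Real.exp (c * (x k : ℝ)) :=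
    b0.continuous_comp Real.continuous_exp
  have b2 : BddMeasurable fun x : Config => Real.exp (-(c * (x k : ℝ))) :=
    b0.continuous_comp (φ := fun t => Real.exp (-t)) (by fun_prop)
  have h1 : ∫ x, Real.exp (c * (x k : ℝ)) ∂μ = ∫ x, Real.exp (-(c * (x k : ℝ))) ∂μ := by
    rw [← integral_flip h _ b1.measurable]
    simp [Config.flip]
  have h2 : ∫ x, Real.exp (c * (x k : ℝ)) ∂μ = ∫ x, Real.cosh (c * (x k : ℝ)) ∂μ := by
    simp only [Real.cosh_eq]
    rw [integral_div, integral_add (b1.integrable μ) (b2.integrable μ), ← h1]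
    ring
  rw [h2]
  have : ∫ _ : Config, Real.exp (3 / 2 * c ^ 2) ∂μ = Real.exp (3 / 2 * c ^ 2) := by simp
  rw [← this]
  refine integral_mono ((b0.continuous_comp Real.continuous_cosh).integrable μ)
    (integrable_const _) fun x => (Real.cosh_le_exp_half_sq _).trans (Real.exp_le_exp.2 ?_)
  have h3 : (x k : ℝ) ^ 2 ≤ 3 := by
    exact (sq_le_sq' (x k).2.1 (x k).2.2).trans_eq (Real.sq_sqrt (by norm_num))
  nlinarith [mul_le_mul_of_nonneg_left h3 (sq_nonneg c)]

section blockLaw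

variable (L : ℕ) [NeZero L] [hL : Fact (Even L)]

lemma integral_exp_linForm_blockLaw_le (hL4 : 4 ≤ L) (J : ℕ) (w : ℤ → ℝ)
    (hw : ∑ k ∈ Finset.range (L ^ J), w k ^ 2 ≤ 1 / 16) :
    ∫ x, Real.exp (linForm (L ^ J) w x) ∂blockLaw L J ≤
      Real.exp (3 / 2 * ∑ k ∈ Finset.range (L ^ J), w k ^ 2 +
        3 * (∑ k ∈ Finset.range (L ^ J), w k ^ 2) ^ 2) := by
  induction J generalizing w with
  | zero =>
    simp only [linForm, pow_zero, Finset.range_one, Finset.sum_singleton]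
    refine (integral_exp_coord_le (measurePreserving_flip_blockLaw L 0) _ _).trans
      (Real.exp_le_exp.2 ?_)
    simp only [le_add_iff_nonneg_right]
    positivity
  | succ J ih =>
    rw [integral_blockLaw_succ_prod L J _ (bddMeasurable_exp_linForm _ _).measurable
      (fun i x => Real.exp (linForm (L ^ J) (childWeight L J w i) x))
      (fun i => bddMeasurable_exp_linForm _ _) (exp_linForm_concat L J w)]
    have hsum := sum_childWeight L J (fun t => t ^ 2) w
    rw [hsum] at hw ⊢
    have hnn : ∀ i : Fin L, 0 ≤ ∑ k ∈ Finset.range (L ^ J), childWeight L J w i k ^ 2 :=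
      fun i => Finset.sum_nonneg fun k _ => sq_nonneg _
    refine sum_prod_exp_le hL4 _ _ _ hnn hw (fun i => integral_nonneg fun x => (Real.exp_pos _).le)
      (fun i => ih _ ?_) fun i => ?_
    · exact (Finset.single_le_sum (fun i _ => hnn i) (Finset.mem_univ i)).trans hw
    · exact sq_integral_exp_mul_odd_le (measurePreserving_flip_blockLaw L J)
        (bddMeasurable_linForm _ _) (bddMeasurable_sgn_linForm _ _) (linForm_flip _ _)
        (fun x => by rw [blockSum_flip, sgn_neg]) fun x => abs_sgn_le _

lemma integral_cosh_linForm_blockLaw_le (hL4 : 4 ≤ L) (J : ℕ) (w : ℤ → ℝ)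
    (hw : ∑ k ∈ Finset.range (L ^ J), w k ^ 2 ≤ 1 / 16) :
    ∫ x, Real.cosh (linForm (L ^ J) w x) ∂blockLaw L J ≤ 2 := by
  set U := ∑ k ∈ Finset.range (L ^ J), w k ^ 2 with hU
  have hU0 : 0 ≤ U := Finset.sum_nonneg fun k _ => sq_nonneg _
  have b1 := bddMeasurable_exp_linForm (L ^ J) w
  have b2 : BddMeasurable fun x => Real.exp (-linForm (L ^ J) w x) :=
    (bddMeasurable_linForm _ _).continuous_comp (φ := fun t => Real.exp (-t)) (by fun_prop)
  have h1 : ∫ x, Real.exp (-linForm (L ^ J) w x) ∂blockLaw L J =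
      ∫ x, Real.exp (linForm (L ^ J) w x) ∂blockLaw L J := by
    rw [← integral_flip (measurePreserving_flip_blockLaw L J) _ b1.measurable]
    simp only [linForm_flip]
  have h2 : Real.exp (3 / 2 * U + 3 * U ^ 2) ≤ 2 := by
    -- `U ≤ 1/16` keeps the exponent below `1/2`, and `√e < 2`.
    have : 3 / 2 * U + 3 * U ^ 2 ≤ 1 / 2 := by nlinarith
    refine (Real.exp_le_exp.2 this).trans ?_
    have h3 : Real.exp (1 / 2) ^ 2 = Real.exp 1 := by rw [← Real.exp_nat_mul]; norm_num
    nlinarith [Real.exp_one_lt_d9, Real.exp_pos (1 / 2)]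
  simp only [Real.cosh_eq]
  rw [integral_div, integral_add (b1.integrable _) (b2.integrable _), h1]
  linarith [integral_exp_linForm_blockLaw_le L hL4 J w hw]

end blockLaw

/-! ### Correlation of a coordinate with the sign of its block sum. -/

lemma integral_pi_perm {n : ℕ} {β : Type*} [MeasurableSpace β] (Λ : Measure β)
    [IsProbabilityMeasure Λ] (e : Equiv.Perm (Fin n)) (G : (Fin n → β) → ℝ) :
    ∫ z, G (z ∘ e) ∂Measure.pi (fun _ : Fin n => Λ) = ∫ z, G z ∂Measure.pi (fun _ : Fin n => Λ) := by
  have h := measurePreserving_piCongrLeft (fun _ : Fin n => Λ) e.symm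
  rw [← h.integral_comp' G]
  refine integral_congr_ae (Eventually.of_forall fun z => ?_)
  refine congrArg G (funext fun i => ?_)
  have := MeasurableEquiv.piCongrLeft_apply_apply (β := fun _ : Fin n => β) e.symm z (e i)
  simp only [Equiv.symm_apply_apply] at this
  exact this.symm

section blockLaw

variable (L : ℕ)

lemma measurable_coord_blockSum (J : ℕ) (k : ℤ) :
    Measurable fun x : Config => ((x k : ℝ), blockSum L J x) :=
  (measurable_subtype_coe.comp (measurable_pi_apply _)).prodMk (measurable_linForm _ _)

variable [NeZero L]

lemma exists_eq_mul_add (J k : ℕ) (hk : k < L ^ (J + 1)) :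
    ∃ (i : Fin L) (r : ℕ), r < L ^ J ∧ (k : ℤ) = ((i : ℕ) : ℤ) * (L : ℤ) ^ J + r := by
  have hpos : 0 < L ^ J := pow_pos (Nat.pos_of_ne_zero (NeZero.ne L)) J
  refine ⟨⟨k / L ^ J, Nat.div_lt_of_lt_mul (by rwa [pow_succ] at hk)⟩, k % L ^ J,
    Nat.mod_lt _ hpos, ?_⟩
  exact_mod_cast (Nat.div_add_mod' k (L ^ J)).symm

lemma blockSum_concat (J : ℕ) (x : Fin L → Config) :
    blockSum L (J + 1) (concat L J x) = ∑ i, blockSum L J (x i) := by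
  rw [blockSum, linForm_concat]; rfl

variable [hL : Fact (Even L)]

/-- Under `blockLaw L J` the coordinates in `[0, L ^ J)` are exchangeable with respect to the block
sum: the joint law of a coordinate and the block sum does not depend on the coordinate. -/
lemma map_coord_blockSum (J k : ℕ) (hk : k < L ^ J) :
    (blockLaw L J).map (fun x => ((x k : ℝ), blockSum L J x)) =
      (blockLaw L J).map fun x => ((x 0 : ℝ), blockSum L J x) := by
  induction J generalizing k with
  | zero =>
    have : k = 0 := by simpa using hk
    subst this; rfl
  | succ J ih =>
    have hpos : 0 < L ^ J := pow_pos (Nat.pos_of_ne_zero (NeZero.ne L)) J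
    set Λ := (blockLaw L J).map fun x => ((x 0 : ℝ), blockSum L J x) with hΛ
    have hΛp : IsProbabilityMeasure Λ :=
      Measure.isProbabilityMeasure_map (measurable_coord_blockSum L J 0).aemeasurable
    let G (F : ℝ × ℝ → ℝ) (i : Fin L) (z : Fin L → ℝ × ℝ) : ℝ :=
      (1 + ∏ j, sgn (z j).2) * F ((z i).1, ∑ j, (z j).2)
    -- Only the independent pairs (coordinate `r` of block `j`, sum of block `j`) enter, each of law
    -- `Λ` by induction. Density and total sum are symmetric in the blocks, so block `i` may be
    -- exchanged with block `0`.
    have key : ∀ (F : ℝ × ℝ → ℝ), Measurable F → ∀ (i : Fin L) (r : ℕ), r < L ^ J →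
        ∫ x, F ((x (((i : ℕ) : ℤ) * (L : ℤ) ^ J + r) : ℝ), blockSum L (J + 1) x)
          ∂blockLaw L (J + 1) = ∫ z, G F 0 z ∂Measure.pi fun _ : Fin L => Λ := by
      intro F hF i r hr
      have hGm : Measurable (G F i) := by
        have h1 : Measurable fun z : Fin L → ℝ × ℝ => ∏ j, sgn (z j).2 :=
          Finset.measurable_prod _ fun j _ => measurable_sgn.comp (by fun_prop)
        have h2 : Measurable fun z : Fin L → ℝ × ℝ => F ((z i).1, ∑ j, (z j).2) :=
          hF.comp (by fun_prop)
        exact (h1.const_add 1).mul h2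
      have hmap : (Measure.pi fun _ : Fin L => blockLaw L J).map
          (fun x j => ((x j r : ℝ), blockSum L J (x j))) = Measure.pi fun _ : Fin L => Λ := by
        have := (measurePreserving_pi (fun _ : Fin L => blockLaw L J) (fun _ : Fin L => Λ)
          (f := fun _ x => ((x r : ℝ), blockSum L J x))
          fun _ => ⟨measurable_coord_blockSum L J r, ih r hr⟩).map_eq
        exact this
      have hmeas : Measurable fun (x : Fin L → Config) j => ((x j r : ℝ), blockSum L J (x j)) :=
        measurable_pi_lambda _ fun j =>
          (measurable_coord_blockSum L J r).comp (measurable_pi_apply j)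
      have hswap : ∀ z : Fin L → ℝ × ℝ, G F i z = G F 0 (z ∘ Equiv.swap 0 i) := by
        intro z
        simp only [G, Function.comp_apply, Equiv.swap_apply_left]
        rw [Equiv.prod_comp (Equiv.swap 0 i) fun j => sgn (z j).2,
          Equiv.sum_comp (Equiv.swap 0 i) fun j => (z j).2]
      rw [integral_blockLaw_succ L J
        (fun x => F ((x (((i : ℕ) : ℤ) * (L : ℤ) ^ J + r) : ℝ), blockSum L (J + 1) x)) (hF.comp (measurable_coord_blockSum L (J + 1) _))]
      rw [← integral_pi_perm Λ (Equiv.swap 0 i) (G F 0)]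
      simp only [← hswap]
      rw [← hmap, integral_map hmeas.aemeasurable hGm.aestronglyMeasurable]
      refine integral_congr_ae (Eventually.of_forall fun x => ?_)
      simp only [G, concat_add L J x i r hr, blockSum_concat, signProd]
    have hint : ∀ k < L ^ (J + 1), ∀ A : Set (ℝ × ℝ), MeasurableSet A →
        (blockLaw L (J + 1)).real ((fun x => ((x k : ℝ), blockSum L (J + 1) x)) ⁻¹' A) =
          ∫ z, G (A.indicator 1) 0 z ∂Measure.pi fun _ : Fin L => Λ := by
      intro k hk A hA
      obtain ⟨i, r, hr, hkr⟩ := exists_eq_mul_add L J k hk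
      rw [← key _ (measurable_one.indicator hA) i r hr, ← hkr,
        ← integral_indicator_one (measurable_coord_blockSum L (J + 1) k hA)]
      rfl
    ext A hA
    have h0 := hint 0 (pow_pos (Nat.pos_of_ne_zero (NeZero.ne L)) _) A hA
    have h1 := hint k hk A hA
    rw [Measure.map_apply (measurable_coord_blockSum L _ k) hA,
      Measure.map_apply (measurable_coord_blockSum L _ 0) hA]
    rw [← h0] at h1
    exact (measureReal_eq_measureReal_iff).1 h1

lemma integral_coord_mul_sgn (J k : ℕ) (hk : k < L ^ J) :
    ∫ x, (x k : ℝ) * sgn (blockSum L J x) ∂blockLaw L J =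
      ∫ x, (x 0 : ℝ) * sgn (blockSum L J x) ∂blockLaw L J := by
  have hm : Measurable fun z : ℝ × ℝ => z.1 * sgn z.2 :=
    measurable_fst.mul (measurable_sgn.comp measurable_snd)
  have h : ∀ k : ℕ, ∫ x, (x k : ℝ) * sgn (blockSum L J x) ∂blockLaw L J =
      ∫ z, z.1 * sgn z.2 ∂(blockLaw L J).map fun x => ((x k : ℝ), blockSum L J x) := fun k => by
    rw [integral_map (measurable_coord_blockSum L J k).aemeasurable hm.aestronglyMeasurable]
  have h0 := h 0
  rw [h k, map_coord_blockSum L J k hk]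
  exact h0.symm

/-- All coordinates have the same correlation with the sign of the block sum; the weight `1`
identifies it, since `S * sgn S = |S|`. In particular nonnegative weights give nonnegative
correlation. -/
lemma integral_linForm_mul_sgn (J : ℕ) (w : ℤ → ℝ) :
    ∫ x, linForm (L ^ J) w x * sgn (blockSum L J x) ∂blockLaw L J =
      (∑ k ∈ Finset.range (L ^ J), w k) *
        ((∫ x, |blockSum L J x| ∂blockLaw L J) / (L : ℝ) ^ J) := by
  have h1 : ∀ w : ℤ → ℝ, ∫ x, linForm (L ^ J) w x * sgn (blockSum L J x) ∂blockLaw L J =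
      (∑ k ∈ Finset.range (L ^ J), w k) *
        ∫ x, (x 0 : ℝ) * sgn (blockSum L J x) ∂blockLaw L J := by
    intro w
    have he : ∀ x, linForm (L ^ J) w x * sgn (blockSum L J x) =
        ∑ k ∈ Finset.range (L ^ J), w k * ((x k : ℝ) * sgn (blockSum L J x)) := fun x => by
      rw [linForm, Finset.sum_mul]
      simp only [mul_assoc]
    simp only [he]
    have hb : ∀ k : ℕ, BddMeasurable fun x : Config => (x k : ℝ) * sgn (blockSum L J x) :=
      fun k => (bddMeasurable_coord k).mul
        (bddMeasurable_sgn_linForm _ _)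
    rw [Finset.sum_mul, integral_finsetSum _ fun k _ => ((hb k).integrable _).const_mul _]
    refine Finset.sum_congr rfl fun k hk => ?_
    rw [integral_const_mul]
    congr 1
    exact integral_coord_mul_sgn L J k (Finset.mem_range.1 hk)
  have h2 := h1 1
  simp only [mul_sgn, Pi.one_apply, Finset.sum_const, Finset.card_range, nsmul_eq_mul,
    mul_one] at h2
  have hpos : (0 : ℝ) < (L : ℝ) ^ J :=
    pow_pos (by exact_mod_cast Nat.pos_of_ne_zero (NeZero.ne L)) J
  rw [h1 w, h2]
  push_cast
  field_simp

end blockLaw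

/-! ### The excess of the `L`-th moment. -/

section blockLaw

variable (L : ℕ)

lemma childWeight_natCast (J : ℕ) (w : ℤ → ℝ) (i : Fin L) (k : ℕ) :
    childWeight L J w i k = w ((i * L ^ J + k : ℕ) : ℤ) := by
  simp [childWeight]

lemma sum_card_fiber (p : Fin L → Fin L) :
    ∑ i, (Finset.univ.filter fun m => p m = i).card = L := by
  have := Finset.card_eq_sum_card_fiberwise (f := p) (s := Finset.univ) (t := Finset.univ)
    (fun _ _ => Finset.mem_coe.2 (Finset.mem_univ _))
  simpa using this.symm

variable [NeZero L]

lemma integral_iidLaw_sum {κ : Type*} (s : Finset κ) (J : ℕ) (F : Config → ℝ) (hF : Measurable F)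
    (f : κ → Fin L → Config → ℝ) (hf : ∀ a i, BddMeasurable (f a i))
    (h : ∀ x, F (concat L J x) = ∑ a ∈ s, ∏ i, f a i (x i)) :
    ∫ x, F x ∂iidLaw = ∑ a ∈ s, ∏ i, ∫ x, f a i x ∂iidLaw := by
  conv_lhs => rw [← map_concat_iidLaw L J]
  rw [integral_map (measurable_concat L J).aemeasurable hF.aestronglyMeasurable]
  simp only [h]
  rw [integral_finsetSum]
  · simp only [integral_fintype_prod_eq_prod]
  · exact fun a _ =>
      (BddMeasurable.prod _ fun i _ => (hf a i).comp (measurable_pi_apply i)).integrable _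

variable [hL : Fact (Even L)]

lemma integral_blockLaw_succ_sum {κ : Type*} (s : Finset κ) (J : ℕ) (F : Config → ℝ)
    (hF : Measurable F) (f : κ → Fin L → Config → ℝ) (hf : ∀ a i, BddMeasurable (f a i))
    (h : ∀ x, F (concat L J x) = ∑ a ∈ s, ∏ i, f a i (x i)) :
    ∫ x, F x ∂blockLaw L (J + 1) = ∑ a ∈ s, (∏ i, ∫ x, f a i x ∂blockLaw L J +
      ∏ i, ∫ x, f a i x * sgn (blockSum L J x) ∂blockLaw L J) := by
  have h1 : ∀ a, BddMeasurable fun x : Fin L → Config => ∏ i, f a i (x i) := fun a =>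
    BddMeasurable.prod _ fun i _ => (hf a i).comp (measurable_pi_apply i)
  have h2 : ∀ a, BddMeasurable fun x : Fin L → Config =>
      ∏ i, f a i (x i) * sgn (blockSum L J (x i)) := fun a =>
    BddMeasurable.prod _ fun i _ =>
      ((hf a i).mul (bddMeasurable_sgn_linForm _ _)).comp (measurable_pi_apply i)
  have h3 : ∀ x, (1 + signProd L J x) * F (concat L J x) =
      ∑ a ∈ s, (∏ i, f a i (x i) + ∏ i, f a i (x i) * sgn (blockSum L J (x i))) := fun x => by
    rw [h, Finset.mul_sum]
    refine Finset.sum_congr rfl fun a _ => ?_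
    rw [Finset.prod_mul_distrib, signProd]
    ring
  rw [integral_blockLaw_succ L J F hF]
  simp only [h3]
  rw [integral_finsetSum _ fun a _ => ((h1 a).add (h2 a)).integrable _]
  refine Finset.sum_congr rfl fun a _ => ?_
  rw [integral_add ((h1 a).integrable _) ((h2 a).integrable _), integral_fintype_prod_eq_prod,
    integral_fintype_prod_eq_prod (fun i x => f a i x * sgn (blockSum L J x))]

/-- Each monomial in the expansion is a product of `e < L` one-coordinate functions. -/
lemma integral_linForm_pow_eq (J e m : ℕ) (he : e < L) (w : ℤ → ℝ) :
    ∫ x, linForm m w x ^ e ∂blockLaw L J = ∫ x, linForm m w x ^ e ∂iidLaw := by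
  have hexp : ∀ x, linForm m w x ^ e = ∑ p ∈ Fintype.piFinset fun _ : Fin e => Finset.range m,
      ∏ i ∈ Finset.univ, (w (p i) * (x (p i : ℤ) : ℝ)) := fun x => by
    rw [← Finset.prod_univ_sum (fun _ : Fin e => Finset.range m)
      (fun _ (k : ℕ) => w k * (x (k : ℤ) : ℝ))]
    simp [linForm]
  have hb : ∀ p : Fin e → ℕ, ∀ i : Fin e, BddMeasurable fun s : Spin => w (p i) * (s : ℝ) :=
    fun p i => (BddMeasurable.const _).mul bddMeasurable_spin
  have hb' : ∀ p : Fin e → ℕ, BddMeasurable fun x : Config =>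
      ∏ i ∈ Finset.univ, (w (p i) * (x (p i : ℤ) : ℝ)) := fun p =>
    BddMeasurable.prod _ fun i _ => (BddMeasurable.const _).mul (bddMeasurable_coord _)
  simp only [hexp]
  rw [integral_finsetSum _ fun p _ => (hb' p).integrable _,
    integral_finsetSum _ fun p _ => (hb' p).integrable _]
  refine Finset.sum_congr rfl fun p _ => ?_
  exact integral_blockLaw_prod_eq L J Finset.univ (fun i s => w (p i) * (s : ℝ)) (hb p)
    (fun i => (p i : ℤ)) (Or.inl (by simpa using he))

/-- The excess of the `L`-th moment of a linear form over its value in the i.i.d. case. -/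
noncomputable def momentGap (J : ℕ) (w : ℤ → ℝ) : ℝ :=
  ∫ x, linForm (L ^ J) w x ^ L ∂blockLaw L J - ∫ x, linForm (L ^ J) w x ^ L ∂iidLaw

/-- The contribution to the excess of the `L`-th moment of the monomials with multidegree `c` in the
sums over the `L` sub-blocks. -/
noncomputable def monomialGap (J : ℕ) (w : ℤ → ℝ) (c : Fin L → ℕ) : ℝ :=
  ∏ i, ∫ x, linForm (L ^ J) (childWeight L J w i) x ^ c i ∂blockLaw L J +
    ∏ i, ∫ x, linForm (L ^ J) (childWeight L J w i) x ^ c i * sgn (blockSum L J x) ∂blockLaw L J -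
    ∏ i, ∫ x, linForm (L ^ J) (childWeight L J w i) x ^ c i ∂iidLaw

/-- Multinomial expansion: `p` assigns to each of the `L` factors the sub-block from which its term
is taken. -/
lemma momentGap_succ (J : ℕ) (w : ℤ → ℝ) :
    momentGap L (J + 1) w =
      ∑ p : Fin L → Fin L, monomialGap L J w fun i => (Finset.univ.filter fun m => p m = i).card := by
  have hexp : ∀ x, linForm (L ^ (J + 1)) w (concat L J x) ^ L =
      ∑ p : Fin L → Fin L, ∏ i, linForm (L ^ J) (childWeight L J w i) (x i) ^
        (Finset.univ.filter fun m => p m = i).card := fun x => by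
    rw [linForm_concat, Fintype.sum_pow]
    refine Finset.sum_congr rfl fun p _ => ?_
    rw [← Finset.prod_fiberwise Finset.univ p]
    refine Finset.prod_congr rfl fun i _ => ?_
    rw [← Finset.prod_const]
    refine Finset.prod_congr rfl fun m hm => ?_
    rw [(Finset.mem_filter.1 hm).2]
  have hF : Measurable fun x => linForm (L ^ (J + 1)) w x ^ L := (measurable_linForm _ _).pow_const _
  have hf : ∀ (p : Fin L → Fin L) (i : Fin L), BddMeasurable fun x =>
      linForm (L ^ J) (childWeight L J w i) x ^ (Finset.univ.filter fun m => p m = i).card :=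
    fun p i => (bddMeasurable_linForm _ _).pow _
  rw [momentGap, integral_blockLaw_succ_sum L _ J _ hF _ hf hexp,
    integral_iidLaw_sum L _ J _ hF _ hf hexp, ← Finset.sum_sub_distrib]
  rfl

lemma integral_sgn_blockSum (J : ℕ) : ∫ x, sgn (blockSum L J x) ∂blockLaw L J = 0 := by
  simpa using integral_sgn_blockSum_of_even L J (fun _ => 1) measurable_const fun _ => rfl

/-- Another block has exponent zero, and its bare sign has mean zero, so no correction appears at
this level. -/
lemma monomialGap_single (hL2 : 2 ≤ L) (J : ℕ) (w : ℤ → ℝ) (c : Fin L → ℕ) (i : Fin L)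
    (hi : c i = L) (hc : ∀ j ≠ i, c j = 0) :
    monomialGap L J w c = momentGap L J (childWeight L J w i) := by
  have : Nontrivial (Fin L) := Fin.nontrivial_iff_two_le.2 hL2
  obtain ⟨j, hj⟩ := exists_ne i
  rw [monomialGap, Finset.prod_eq_single i (fun j _ hj => by simp [hc j hj]) (by simp),
    Finset.prod_eq_zero (Finset.mem_univ j) (by simp [hc j hj, integral_sgn_blockSum]),
    Finset.prod_eq_single i (fun j _ hj => by simp [hc j hj]) (by simp), hi, momentGap, add_zero]

lemma monomialGap_of_lt (J : ℕ) (w : ℤ → ℝ) (c : Fin L → ℕ) (hc : ∀ i, c i < L) :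
    monomialGap L J w c = ∏ i, ∫ x, linForm (L ^ J) (childWeight L J w i) x ^ c i *
      sgn (blockSum L J x) ∂blockLaw L J := by
  rw [monomialGap, Finset.prod_congr rfl fun i _ => integral_linForm_pow_eq L J (c i) _ (hc i) _]
  ring

lemma integral_linForm_mul_sgn_nonneg (J : ℕ) (w : ℤ → ℝ) (hw : ∀ k : ℕ, 0 ≤ w k) :
    0 ≤ ∫ x, linForm (L ^ J) w x * sgn (blockSum L J x) ∂blockLaw L J := by
  rw [integral_linForm_mul_sgn]
  exact mul_nonneg (Finset.sum_nonneg fun k _ => hw k)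
    (div_nonneg (integral_nonneg fun _ => abs_nonneg _) (by positivity))

/-- Degree `L` spread over `L` blocks leaves three cases: all in one block, giving the gap of that
child; some exponent zero and none equal to `L`, giving zero; or all exponents one, giving a product
of nonnegative correlations. -/
lemma monomialGap_nonneg (hL2 : 2 ≤ L) (J : ℕ) (w : ℤ → ℝ) (hw : ∀ k : ℕ, 0 ≤ w k)
    (hgap : ∀ i, 0 ≤ momentGap L J (childWeight L J w i)) (c : Fin L → ℕ) (hc : ∑ i, c i = L) :
    0 ≤ monomialGap L J w c := by
  by_cases h : ∀ i, c i < L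
  · rw [monomialGap_of_lt L J w c h]
    by_cases h0 : ∃ i, c i = 0
    · obtain ⟨i, hi⟩ := h0
      rw [Finset.prod_eq_zero (Finset.mem_univ i) (by simp [hi, integral_sgn_blockSum])]
    · push Not at h0
      have h1 : ∀ i, c i = 1 := by
        have : ∀ i ∈ Finset.univ, 1 = c i := by
          refine (Finset.sum_eq_sum_iff_of_le fun i _ => Nat.one_le_iff_ne_zero.2 (h0 i)).1 ?_
          simp [hc]
        exact fun i => (this i (Finset.mem_univ i)).symm
      simp only [h1, pow_one]
      exact Finset.prod_nonneg fun i _ => integral_linForm_mul_sgn_nonneg L J _ fun k => by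
        rw [childWeight_natCast]; exact hw _
  · push Not at h
    obtain ⟨i, hi⟩ := h
    have hsum := Finset.add_sum_erase Finset.univ c (Finset.mem_univ i)
    have h0 : ∑ j ∈ Finset.univ.erase i, c j = 0 := by omega
    rw [monomialGap_single L hL2 J w c i (by omega) fun j hj =>
      Finset.sum_eq_zero_iff.1 h0 j (Finset.mem_erase.2 ⟨hj, Finset.mem_univ j⟩)]
    exact hgap i

lemma momentGap_nonneg (hL2 : 2 ≤ L) (J : ℕ) (w : ℤ → ℝ) (hw : ∀ k : ℕ, 0 ≤ w k) :
    0 ≤ momentGap L J w := by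
  induction J generalizing w with
  | zero => rw [momentGap]; exact (sub_self _).ge
  | succ J ih =>
    rw [momentGap_succ]
    exact Finset.sum_nonneg fun p _ => monomialGap_nonneg L hL2 J w hw
      (fun i => ih _ fun k => by rw [childWeight_natCast]; exact hw _) _ (sum_card_fiber L p)

lemma monomialGap_le_momentGap_succ (hL2 : 2 ≤ L) (J : ℕ) (w : ℤ → ℝ) (hw : ∀ k : ℕ, 0 ≤ w k)
    (p : Fin L → Fin L) :
    monomialGap L J w (fun i => (Finset.univ.filter fun m => p m = i).card) ≤
      momentGap L (J + 1) w := by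
  rw [momentGap_succ]
  exact Finset.single_le_sum (f := fun p : Fin L → Fin L =>
    monomialGap L J w fun i => (Finset.univ.filter fun m => p m = i).card)
    (fun p _ => monomialGap_nonneg L hL2 J w hw
      (fun i => momentGap_nonneg L hL2 J _ fun k => by rw [childWeight_natCast]; exact hw _) _
      (sum_card_fiber L p)) (Finset.mem_univ p)

/-- Keeps the single term of the expansion with constant `p`; the next lemma keeps the term `p =
id`. -/
lemma momentGap_child_le (hL2 : 2 ≤ L) (J : ℕ) (w : ℤ → ℝ) (hw : ∀ k : ℕ, 0 ≤ w k) (i : Fin L) :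
    momentGap L J (childWeight L J w i) ≤ momentGap L (J + 1) w := by
  have := monomialGap_le_momentGap_succ L hL2 J w hw fun _ => i
  rwa [monomialGap_single L hL2 J w _ i (by simp) (fun j hj => by simp [hj.symm])] at this

lemma prod_le_momentGap_succ (hL2 : 2 ≤ L) (J : ℕ) (w : ℤ → ℝ) (hw : ∀ k : ℕ, 0 ≤ w k) :
    ∏ i, ∫ x, linForm (L ^ J) (childWeight L J w i) x * sgn (blockSum L J x) ∂blockLaw L J ≤
      momentGap L (J + 1) w := by
  have := monomialGap_le_momentGap_succ L hL2 J w hw id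
  have hc : ∀ i : Fin L, (Finset.univ.filter fun m => id m = i).card = 1 := fun i =>
    Finset.card_eq_one.2 ⟨i, by ext; simp⟩
  simp only [hc] at this
  rw [monomialGap_of_lt L J w _ fun _ => by omega] at this
  simpa using this

/-- A weight which equals one on a whole block of level `j + 1` has a definite moment gap. -/
lemma pow_le_momentGap (hL2 : 2 ≤ L) (j J : ℕ) (hJ : j + 1 ≤ J) (q : ℕ) (hq : L ^ (j + 1) ∣ q)
    (hqJ : q + L ^ (j + 1) ≤ L ^ J) (w : ℤ → ℝ) (hw : ∀ k : ℕ, 0 ≤ w k)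
    (hw1 : ∀ k : ℕ, q ≤ k → k < q + L ^ (j + 1) → w k = 1) :
    (∫ x, |blockSum L j x| ∂blockLaw L j) ^ L ≤ momentGap L J w := by
  induction J, hJ using Nat.le_induction generalizing q w with
  | base =>
    have hq0 : q = 0 := by omega
    subst hq0
    refine le_trans (le_of_eq ?_) (prod_le_momentGap_succ L hL2 j w hw)
    have : ∀ (i : Fin L) (x : Config), linForm (L ^ j) (childWeight L j w i) x *
        sgn (blockSum L j x) = |blockSum L j x| := fun i x => by
      rw [← mul_sgn]
      congr 1
      refine Finset.sum_congr rfl fun k hk => ?_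
      have h1 : (i : ℕ) * L ^ j + k < L ^ (j + 1) := by
        have := Finset.mem_range.1 hk
        calc (i : ℕ) * L ^ j + k < i * L ^ j + L ^ j := by omega
          _ = (i + 1) * L ^ j := by ring
          _ ≤ L * L ^ j := Nat.mul_le_mul_right _ i.2
          _ = L ^ (j + 1) := by ring
      rw [childWeight_natCast, hw1 _ (Nat.zero_le _) (by omega), Pi.one_apply]
    simp [this]
  | succ J hJ ih =>
    have hLpos : 0 < L := by omega
    have hpos : 0 < L ^ J := pow_pos hLpos J
    have hposj : 0 < L ^ (j + 1) := pow_pos hLpos _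
    have hdvd : L ^ (j + 1) ∣ L ^ J := pow_dvd_pow L hJ
    have hlt : q / L ^ J < L := Nat.div_lt_of_lt_mul (by rw [← pow_succ]; omega)
    have hmod : L ^ (j + 1) ∣ q % L ^ J := (Nat.dvd_mod_iff hdvd).2 hq
    -- Both `q % L ^ J` and `L ^ J` are multiples of `L ^ (j + 1)`, so the aligned block lies inside
    -- one child, to which the induction descends.
    have hle : q % L ^ J + L ^ (j + 1) ≤ L ^ J := by
      have h1 := Nat.mod_lt q hpos
      have h2 : L ^ (j + 1) ∣ L ^ J - q % L ^ J := Nat.dvd_sub hdvd hmod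
      have := Nat.le_of_dvd (by omega) h2
      omega
    refine (ih (q % L ^ J) hmod hle (childWeight L J w ⟨q / L ^ J, hlt⟩)
      (fun k => by rw [childWeight_natCast]; exact hw _) fun k hk1 hk2 => ?_).trans
      (momentGap_child_le L hL2 J w hw ⟨q / L ^ J, hlt⟩)
    have := Nat.div_add_mod' q (L ^ J)
    rw [childWeight_natCast]
    exact hw1 _ (by simp only; omega) (by simp only; omega)

end blockLaw

/-! ### Partial sums over windows and the i.i.d. reference values. -/

lemma iIndepFun_coord_iidLaw : iIndepFun (fun (k : ℤ) (x : Config) => (x k : ℝ)) iidLaw :=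
  iIndepFun_infinitePi (P := fun _ : ℤ => spinLaw) (X := fun _ s => (s : ℝ))
    fun _ => measurable_subtype_coe

lemma integral_comp_coord_iidLaw (k : ℤ) (f : Spin → ℝ) (hf : Measurable f) :
    ∫ x : Config, f (x k) ∂iidLaw = ∫ s, f s ∂spinLaw := by
  conv_rhs => rw [← Measure.infinitePi_map_eval (fun _ : ℤ => spinLaw) k]
  rw [integral_map (measurable_pi_apply k).aemeasurable hf.aestronglyMeasurable]
  rfl

lemma integral_coord_iidLaw (k : ℤ) : ∫ x : Config, (x k : ℝ) ∂iidLaw = 0 := by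
  rw [integral_comp_coord_iidLaw k (fun s => (s : ℝ)) measurable_subtype_coe, integral_spin]

lemma integral_coord_mul_coord_iidLaw (k l : ℤ) :
    ∫ x : Config, (x k : ℝ) * (x l : ℝ) ∂iidLaw = if k = l then 1 else 0 := by
  split_ifs with h
  · subst h
    simp only [← pow_two]
    rw [integral_comp_coord_iidLaw k (fun s => (s : ℝ) ^ 2) (measurable_subtype_coe.pow_const 2),
      integral_spin_sq]
  · have := (iIndepFun_coord_iidLaw.indepFun h).integral_fun_mul_eq_mul_integral
      (bddMeasurable_coord k).measurable.aestronglyMeasurable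
      (bddMeasurable_coord l).measurable.aestronglyMeasurable
    rw [this, integral_coord_iidLaw, zero_mul]

/-- The partial sum `x_1 + ⋯ + x_n`. -/
noncomputable def startSum (n : ℕ) (x : Config) : ℝ := ∑ k ∈ Finset.range n, (x ((k : ℤ) + 1) : ℝ)

/-- The shifted configuration. -/
def shift (r : ℤ) (x : Config) : Config := fun k => x (k + r)

lemma continuous_shift (r : ℤ) : Continuous (shift r) :=
  continuous_pi fun k => continuous_apply (k + r)

lemma continuous_startSum (n : ℕ) : Continuous (startSum n) := by
  unfold startSum
  exact continuous_finsetSum _ fun _ _ => continuous_subtype_val.comp (continuous_apply _)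

lemma measurable_shift (r : ℤ) : Measurable (shift r) :=
  measurable_pi_lambda _ fun _ => measurable_pi_apply _

lemma bddMeasurable_startSum (n : ℕ) : BddMeasurable (startSum n) :=
  BddMeasurable.sum _ fun _ _ => bddMeasurable_coord _

lemma map_shift_iidLaw (r : ℤ) : iidLaw.map (shift r) = iidLaw := by
  refine Measure.eq_infinitePi _ fun s t ht => ?_
  have hpre : shift r ⁻¹' Set.pi (s : Set ℤ) t =
      Set.pi ((s.image fun k => k + r : Finset ℤ) : Set ℤ) fun k => t (k - r) := by
    ext x
    simp only [Set.mem_preimage, Set.mem_pi, shift, Finset.coe_image, Set.forall_mem_image,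
      add_sub_cancel_right]
  rw [Measure.map_apply (measurable_shift r) (.pi s.countable_toSet fun i _ => ht i), hpre, iidLaw,
    Measure.infinitePi_pi _ (fun i _ => ht _), Finset.prod_image fun a _ b _ h => by simpa using h]
  simp

lemma integral_shift_iidLaw (r : ℤ) (f : Config → ℝ) (hf : Measurable f) :
    ∫ x, f (shift r x) ∂iidLaw = ∫ x, f x ∂iidLaw := by
  conv_rhs => rw [← map_shift_iidLaw r]
  rw [integral_map (measurable_shift r).aemeasurable hf.aestronglyMeasurable]

lemma integral_linForm_sq_iidLaw (m : ℕ) (w : ℤ → ℝ) :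
    ∫ x, linForm m w x ^ 2 ∂iidLaw = ∑ k ∈ Finset.range m, w k ^ 2 := by
  have he : ∀ x : Config, linForm m w x ^ 2 = ∑ k ∈ Finset.range m, ∑ l ∈ Finset.range m,
      w k * w l * ((x k : ℝ) * (x l : ℝ)) := fun x => by
    rw [linForm, pow_two, Finset.sum_mul_sum]
    exact Finset.sum_congr rfl fun k _ => Finset.sum_congr rfl fun l _ => by ring
  have hb : ∀ k l : ℕ, Integrable (fun x : Config => w k * w l * ((x k : ℝ) * (x l : ℝ))) iidLaw :=
    fun k l => (((bddMeasurable_coord _).mul (bddMeasurable_coord _)).integrable _).const_mul _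
  simp only [he]
  rw [integral_finsetSum _ fun k _ => integrable_finsetSum _ fun l _ => hb k l]
  refine Finset.sum_congr rfl fun k hk => ?_
  rw [integral_finsetSum _ fun l _ => hb k l]
  simp only [integral_const_mul, integral_coord_mul_coord_iidLaw, Nat.cast_inj, mul_ite, mul_one,
    mul_zero, Finset.sum_ite_eq, hk, if_true]
  ring

/-- The indicator weight of the interval `[a, a + n)`. -/
noncomputable def intervalWeight (a n : ℕ) (c : ℝ) (k : ℤ) : ℝ :=
  if (a : ℤ) ≤ k ∧ k < (a : ℤ) + n then c else 0

lemma sum_intervalWeight (a n m : ℕ) (h : a + n ≤ m) (c : ℝ) (f : ℕ → ℝ) :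
    ∑ k ∈ Finset.range m, intervalWeight a n c k * f k = c * ∑ k ∈ Finset.range n, f (a + k) := by
  have h1 : ∀ k : ℕ, intervalWeight a n c k * f k = if k ∈ Finset.Ico a (a + n) then c * f k else 0 :=
    fun k => by
      simp only [intervalWeight, Finset.mem_Ico, ← Nat.cast_add, Nat.cast_le, Nat.cast_lt, ite_mul,
        zero_mul]
  simp only [h1]
  rw [← Finset.sum_filter, Finset.mul_sum]
  have : (Finset.range m).filter (fun k => k ∈ Finset.Ico a (a + n)) = Finset.Ico a (a + n) := by
    ext k; simp only [Finset.mem_filter, Finset.mem_range, Finset.mem_Ico]; omega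
  rw [this, Finset.sum_Ico_eq_sum_range]
  simp

/-- Since `startSum` begins at index `1`, the window shifted by `r` occupies `[r + 1, r + 1 + n)`.
-/
lemma linForm_intervalWeight (r n m : ℕ) (h : r + 1 + n ≤ m) (c : ℝ) (x : Config) :
    linForm m (intervalWeight (r + 1) n c) x = c * startSum n (shift r x) := by
  rw [linForm, sum_intervalWeight (r + 1) n m h c fun k => (x k : ℝ), startSum]
  congr 1
  refine Finset.sum_congr rfl fun k _ => ?_
  simp only [shift]
  congr 2
  push_cast
  ring

lemma sum_intervalWeight_sq (a n m : ℕ) (h : a + n ≤ m) (c : ℝ) :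
    ∑ k ∈ Finset.range m, intervalWeight a n c k ^ 2 = n * c ^ 2 := by
  have h1 : ∀ k : ℕ, intervalWeight a n c k ^ 2 = intervalWeight a n (c ^ 2) k * 1 := fun k => by
    simp only [intervalWeight]; split_ifs <;> simp
  simp only [h1]
  rw [sum_intervalWeight a n m h (c ^ 2) fun _ => 1]
  simp [mul_comm]

lemma integral_exp_startSum_iidLaw_le (n : ℕ) (c : ℝ) :
    ∫ x, Real.exp (c * startSum n x) ∂iidLaw ≤ Real.exp (3 / 2 * c ^ 2) ^ n := by
  have h1 := iIndepFun_coord_iidLaw.mgf_sum (t := c) (fun k => (bddMeasurable_coord k).measurable)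
    ((Finset.range n).map ⟨fun k : ℕ => (k : ℤ) + 1, fun a b h => by simpa using h⟩)
  rw [Finset.sum_map, Finset.prod_map] at h1
  have h2 : ∫ x, Real.exp (c * startSum n x) ∂iidLaw = ∏ k ∈ Finset.range n,
      mgf (fun x : Config => (x ((k : ℤ) + 1) : ℝ)) iidLaw c := by
    refine Eq.trans ?_ h1
    simp only [mgf, startSum, Finset.sum_apply]
    rfl
  rw [h2]
  calc ∏ k ∈ Finset.range n, mgf (fun x : Config => (x ((k : ℤ) + 1) : ℝ)) iidLaw c
      ≤ ∏ k ∈ Finset.range n, Real.exp (3 / 2 * c ^ 2) :=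
        Finset.prod_le_prod (fun k _ => mgf_nonneg)
          fun k _ => integral_exp_coord_le measurePreserving_flip_iidLaw c _
    _ = _ := by simp

/-- At scale `1 / (4 √n)` a window meets the threshold `1/16` of the exponential bound. -/
lemma sq_le_inv_four_sqrt (n : ℕ) : (n : ℝ) * (4 * √n)⁻¹ ^ 2 ≤ 1 / 16 := by
  rcases Nat.eq_zero_or_pos n with rfl | hn
  · simp
  · have : (0 : ℝ) < n := by exact_mod_cast hn
    rw [inv_pow, mul_pow, Real.sq_sqrt this.le]
    field_simp
    norm_num

lemma integral_cosh_startSum_iidLaw_le (n : ℕ) :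
    ∫ x, Real.cosh ((4 * √n)⁻¹ * startSum n x) ∂iidLaw ≤ 2 := by
  have hb : ∀ c : ℝ, BddMeasurable fun x => Real.exp (c * startSum n x) := fun c =>
    ((BddMeasurable.const c).mul (bddMeasurable_startSum n)).continuous_comp Real.continuous_exp
  have hle : ∀ c : ℝ, n * c ^ 2 ≤ 1 / 16 → ∫ x, Real.exp (c * startSum n x) ∂iidLaw ≤ 2 := by
    intro c hc
    refine (integral_exp_startSum_iidLaw_le n c).trans ?_
    rw [← Real.exp_nat_mul]
    refine (Real.exp_le_exp.2 (show _ ≤ (1 / 2 : ℝ) by linarith)).trans ?_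
    have h3 : Real.exp (1 / 2) ^ 2 = Real.exp 1 := by rw [← Real.exp_nat_mul]; norm_num
    nlinarith [Real.exp_one_lt_d9, Real.exp_pos (1 / 2)]
  simp only [Real.cosh_eq, ← neg_mul]
  rw [integral_div, integral_add ((hb _).integrable _) ((hb _).integrable _)]
  linarith [hle _ (sq_le_inv_four_sqrt n), hle (-(4 * √n)⁻¹) (by
    rw [neg_sq]; exact sq_le_inv_four_sqrt n)]

/-! ### Lower bounds for absolute moments and for the window excess. -/

lemma pow_le_factorial_mul_cosh (t : ℝ) (p : ℕ) :
    |t| ^ p ≤ 2 * p.factorial * Real.cosh t := by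
  have h1 := Real.pow_div_factorial_le_exp |t| (abs_nonneg t) p
  rw [div_le_iff₀ (by positivity)] at h1
  have h2 : Real.exp |t| ≤ 2 * Real.cosh t := by
    rw [← Real.cosh_abs, Real.cosh_eq]
    linarith [Real.exp_pos (-|t|)]
  have : (0 : ℝ) ≤ p.factorial := by positivity
  nlinarith

/-- Turns a second moment and a fourth-moment bound into a lower bound for a first absolute moment.
-/
lemma sub_le_abs_mul (u : ℝ) : u ^ 2 - u ^ 4 ≤ |u| := by
  have h : u ^ 2 = |u| ^ 2 := (sq_abs u).symm
  have h4 : u ^ 4 = |u| ^ 4 := by rw [show u ^ 4 = (u ^ 2) ^ 2 by ring, h]; ring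
  rw [h, h4]
  have := abs_nonneg u
  nlinarith [mul_nonneg this (sq_nonneg (|u| - 1)), mul_nonneg this (sq_nonneg (|u|)),
    mul_nonneg this (mul_nonneg this this), sq_nonneg (|u|^2 - |u|), sq_nonneg (|u| - 1),
    mul_nonneg this (sq_nonneg (|u| - 1/2))]

section blockLaw

variable (L : ℕ) [NeZero L] [hL : Fact (Even L)]

lemma le_integral_abs_blockSum (hL4 : 4 ≤ L) (J : ℕ) :
    √((L : ℝ) ^ J) / 1024 ≤ ∫ x, |blockSum L J x| ∂blockLaw L J := by
  have hLpos : (0 : ℝ) < (L : ℝ) ^ J := pow_pos (by exact_mod_cast (by omega : 0 < L)) J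
  set s := √((L : ℝ) ^ J) with hs
  have hspos : 0 < s := Real.sqrt_pos.2 hLpos
  have hsq : s ^ 2 = (L : ℝ) ^ J := Real.sq_sqrt hLpos.le
  have hb : BddMeasurable (blockSum L J) := bddMeasurable_linForm _ _
  have h2 : ∫ x, blockSum L J x ^ 2 ∂blockLaw L J = s ^ 2 := by
    rw [integral_linForm_pow_eq L J 2 _ (by omega), integral_linForm_sq_iidLaw, hsq]
    simp
  have hlin : ∀ x, linForm (L ^ J) (fun _ => (4 * s)⁻¹) x = (4 * s)⁻¹ * blockSum L J x := fun x => by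
    simp [linForm, Finset.mul_sum]
  have hcosh : ∫ x, Real.cosh ((4 * s)⁻¹ * blockSum L J x) ∂blockLaw L J ≤ 2 := by
    simp only [← hlin]
    refine integral_cosh_linForm_blockLaw_le L hL4 J _ ?_
    rw [Finset.sum_const, Finset.card_range, nsmul_eq_mul, inv_pow, mul_pow, hsq]
    push_cast
    field_simp
    norm_num
  have h4 : ∫ x, ((4 * s)⁻¹ * blockSum L J x) ^ 4 ∂blockLaw L J ≤ 96 := by
    have hc : BddMeasurable fun x => (4 * s)⁻¹ * blockSum L J x := (BddMeasurable.const _).mul hb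
    calc ∫ x, ((4 * s)⁻¹ * blockSum L J x) ^ 4 ∂blockLaw L J
        ≤ ∫ x, 48 * Real.cosh ((4 * s)⁻¹ * blockSum L J x) ∂blockLaw L J := by
          refine integral_mono ((hc.pow 4).integrable _)
            (((hc.continuous_comp Real.continuous_cosh).integrable _).const_mul _) fun x => ?_
          have := pow_le_factorial_mul_cosh ((4 * s)⁻¹ * blockSum L J x) 4
          rw [show |(4 * s)⁻¹ * blockSum L J x| ^ 4 = ((4 * s)⁻¹ * blockSum L J x) ^ 4 from
            Even.pow_abs (by decide) _] at this
          norm_num [Nat.factorial] at this ⊢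
          linarith
      _ ≤ 96 := by rw [integral_const_mul]; linarith
  -- With this scale the second moment of `K * S` is `2⁻¹⁶` and its fourth moment is at most `96 *
  -- 2⁻²⁴`; the difference exceeds `2⁻¹⁸ = 1/1024 * 1/256`.
  set K := (256 * s)⁻¹ with hK
  have hKpos : 0 < K := by positivity
  have key : ∫ x, ((K * blockSum L J x) ^ 2 - (K * blockSum L J x) ^ 4) ∂blockLaw L J ≤
      ∫ x, K * |blockSum L J x| ∂blockLaw L J := by
    have hc : BddMeasurable fun x => K * blockSum L J x := (BddMeasurable.const _).mul hb
    refine integral_mono (((hc.pow 2).integrable _).sub ((hc.pow 4).integrable _))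
      (((hb.continuous_comp continuous_abs).integrable _).const_mul _) fun x => ?_
    have := sub_le_abs_mul (K * blockSum L J x)
    rwa [abs_mul, abs_of_pos hKpos] at this
  have hb' : BddMeasurable fun x => K * blockSum L J x := (BddMeasurable.const _).mul hb
  rw [integral_sub ((hb'.pow 2).integrable _) ((hb'.pow 4).integrable _),
    integral_const_mul] at key
  have e4 : ∀ x, (K * blockSum L J x) ^ 4 = (1 / 64) ^ 4 * ((4 * s)⁻¹ * blockSum L J x) ^ 4 :=
    fun x => by
      rw [← mul_pow]
      congr 1
      rw [hK]; field_simp; ring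
  simp only [e4, mul_pow K _ 2, integral_const_mul, h2] at key
  have hKs : K * s = 1 / 256 := by rw [hK]; field_simp
  have h5 : K ^ 2 * s ^ 2 = (1 / 256) ^ 2 := by rw [← mul_pow, hKs]
  rw [h5] at key
  have h6 : (1 / 1024 : ℝ) * (1 / 256) ≤ K * ∫ x, |blockSum L J x| ∂blockLaw L J := by
    refine le_trans ?_ key
    linarith
  rw [← hKs] at h6
  have h7 : K * (s / 1024) ≤ K * ∫ x, |blockSum L J x| ∂blockLaw L J := by linarith
  exact le_of_mul_le_mul_left h7 hKpos

lemma integral_cosh_window_le (hL4 : 4 ≤ L) (J r n : ℕ) (h : r + 1 + n ≤ L ^ J) :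
    ∫ x, Real.cosh ((4 * √n)⁻¹ * startSum n (shift r x)) ∂blockLaw L J ≤ 2 := by
  simp only [← linForm_intervalWeight r n (L ^ J) h]
  refine integral_cosh_linForm_blockLaw_le L hL4 J _ ?_
  rw [sum_intervalWeight_sq _ _ _ h]
  exact sq_le_inv_four_sqrt n

lemma integral_window_pow_eq (J r n e : ℕ) (he : e < L) (h : r + 1 + n ≤ L ^ J) :
    ∫ x, startSum n (shift r x) ^ e ∂blockLaw L J = ∫ x, startSum n x ^ e ∂iidLaw := by
  rw [← integral_shift_iidLaw r _ ((bddMeasurable_startSum n).pow e).measurable]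
  have := integral_linForm_pow_eq L J e (L ^ J) he (intervalWeight (r + 1) n 1)
  simpa only [linForm_intervalWeight r n (L ^ J) h, one_mul] using this

lemma window_pow_gap (hL4 : 4 ≤ L) (J r n : ℕ) (h : r + 1 + n ≤ L ^ J) (hn : 2 * L ≤ n) :
    ∫ x, startSum n x ^ L ∂iidLaw + (√n / (2048 * L)) ^ L ≤
      ∫ x, startSum n (shift r x) ^ L ∂blockLaw L J := by
  have hL1 : 1 < L := by omega
  obtain ⟨j, hj⟩ : ∃ j, Nat.log L (n / 2) = j + 1 := by
    have : 0 < Nat.log L (n / 2) := Nat.log_pos hL1 (by omega)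
    exact ⟨Nat.log L (n / 2) - 1, by omega⟩
  have hlow : L ^ (j + 1) ≤ n / 2 := by
    rw [← hj]; exact Nat.pow_log_le_self L (by omega)
  have hup : n / 2 < L ^ (j + 2) := by
    rw [show j + 2 = (j + 1) + 1 by ring, ← hj]; exact Nat.lt_pow_succ_log_self hL1 _
  set B := L ^ (j + 1) with hB
  have hBpos : 0 < B := pow_pos (by omega) _
  have hJ : j + 1 ≤ J := (Nat.pow_le_pow_iff_right hL1).1 (by omega : L ^ (j + 1) ≤ L ^ J)
  -- The first multiple of `B` not before `r + 1`. As `2 * B ≤ n`, the aligned block `[q, q + B)`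
  -- fits in the window.
  set q := (r + 1 + (B - 1)) / B * B with hq
  have hq1 : q ≤ r + 1 + (B - 1) := Nat.div_mul_le_self _ _
  have hq2 : r + 1 ≤ q := by
    have := Nat.lt_div_mul_add (a := r + 1 + (B - 1)) hBpos
    omega
  have hgap := pow_le_momentGap L (by omega) j J hJ q (Dvd.intro_left _ rfl) (by omega)
    (intervalWeight (r + 1) n 1) (fun k => by unfold intervalWeight; split_ifs <;> norm_num)
    (fun k hk1 hk2 => by
      unfold intervalWeight
      rw [if_pos]
      constructor
      · exact_mod_cast hq2.trans hk1
      · have : k < r + 1 + n := by omega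
        exact_mod_cast this)
  have habs := le_integral_abs_blockSum L hL4 j
  have hsqrt : √n / (2048 * L) ≤ √((L : ℝ) ^ j) / 1024 := by
    have h1 : √n ≤ √((L : ℝ) ^ j) * (2 * L) := by
      rw [← Real.sqrt_sq (show (0 : ℝ) ≤ 2 * L by positivity), ← Real.sqrt_mul (by positivity)]
      refine Real.sqrt_le_sqrt ?_
      have : n ≤ L ^ j * (2 * L) ^ 2 := by
        have : L ^ (j + 2) = L ^ j * L ^ 2 := by ring
        have h3 : L ^ j * (2 * L) ^ 2 = 4 * L ^ (j + 2) := by ring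
        omega
      exact_mod_cast this
    have hLr : (0 : ℝ) < L := by exact_mod_cast (by omega : 0 < L)
    rw [div_le_div_iff₀ (by positivity) (by norm_num)]
    linarith
  have hle := (pow_le_pow_left₀ (by positivity) (hsqrt.trans habs) L).trans hgap
  rw [momentGap] at hle
  simp only [linForm_intervalWeight r n (L ^ J) h, one_mul] at hle
  rw [integral_shift_iidLaw r (fun x => startSum n x ^ L)
    ((bddMeasurable_startSum n).pow L).measurable] at hle
  linarith

end blockLaw

/-! ### The stationary limit law. -/

open scoped Topology BoundedContinuousFunction

lemma measure_pi_ext_of_integral_prod {α E : Type*} [Fintype α] [MeasurableSpace E]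
    {μ ν : Measure (α → E)} [IsProbabilityMeasure μ] [IsProbabilityMeasure ν]
    (h : ∀ f : α → E → ℝ, (∀ a, BddMeasurable (f a)) →
      ∫ y, ∏ a, f a (y a) ∂μ = ∫ y, ∏ a, f a (y a) ∂ν) : μ = ν := by
  refine ext_of_generate_finite _ generateFrom_pi.symm
    isPiSystem_pi ?_ (by simp)
  rintro _ ⟨t, ht, rfl⟩
  have ht' : ∀ a, MeasurableSet (t a) := fun a => ht a (Set.mem_univ a)
  have hind : ∀ y : α → E, ∏ a, (t a).indicator (1 : E → ℝ) (y a) =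
      (Set.univ.pi t).indicator (1 : (α → E) → ℝ) y := fun y => by
    classical
    by_cases hy : y ∈ Set.univ.pi t
    · rw [Set.indicator_of_mem hy]
      exact Finset.prod_eq_one fun a _ => Set.indicator_of_mem (hy a (Set.mem_univ a)) _
    · rw [Set.indicator_of_notMem hy]
      simp only [Set.mem_pi, Set.mem_univ, forall_true_left, not_forall] at hy
      obtain ⟨a, ha⟩ := hy
      exact Finset.prod_eq_zero (Finset.mem_univ a) (Set.indicator_of_notMem ha _)
  have := h (fun a => (t a).indicator 1) fun a => ⟨measurable_one.indicator (ht' a), 1, fun x => by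
    by_cases hx : x ∈ t a <;> simp [hx]⟩
  simp only [hind] at this
  have hm : MeasurableSet (Set.univ.pi t) := MeasurableSet.univ_pi ht'
  rw [integral_indicator_one hm, integral_indicator_one hm] at this
  exact (measureReal_eq_measureReal_iff).1 this

lemma tendsto_inv_pow_mul_const (L : ℕ) (hL2 : 2 ≤ L) (c : ℝ) :
    Tendsto (fun J : ℕ => ((L ^ J : ℕ) : ℝ)⁻¹ * c) atTop (𝓝 0) := by
  have h : Tendsto (fun J : ℕ => ((L ^ J : ℕ) : ℝ)) atTop atTop := by
    push_cast
    exact tendsto_pow_atTop_atTop_of_one_lt (by exact_mod_cast (by omega : 1 < L))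
  simpa using (tendsto_inv_atTop_zero.comp h).mul_const c

section blockLaw

variable (L : ℕ) [NeZero L] [hL : Fact (Even L)]

/-- The average of the translates of `blockLaw L J` over one block. -/
noncomputable def averagedLaw (J : ℕ) : Measure Config :=
  ((L ^ J : ℕ) : ENNReal)⁻¹ • ∑ r ∈ Finset.range (L ^ J), (blockLaw L J).map (shift r)

lemma isProbabilityMeasure_map_shift (J : ℕ) (r : ℤ) :
    IsProbabilityMeasure ((blockLaw L J).map (shift r)) :=
  Measure.isProbabilityMeasure_map (measurable_shift r).aemeasurable

instance isProbabilityMeasure_averagedLaw (J : ℕ) : IsProbabilityMeasure (averagedLaw L J) := by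
  constructor
  have hpos : L ^ J ≠ 0 := pow_ne_zero _ (NeZero.ne L)
  have h : ∀ r : ℕ, (blockLaw L J).map (shift r) Set.univ = 1 := fun r =>
    (isProbabilityMeasure_map_shift L J r).measure_univ
  simp only [averagedLaw, Measure.smul_apply, Measure.coe_finsetSum, Finset.sum_apply, h,
    Finset.sum_const, Finset.card_range, smul_eq_mul, nsmul_eq_mul, mul_one]
  exact ENNReal.inv_mul_cancel (by exact_mod_cast hpos) (ENNReal.natCast_ne_top _)

lemma integral_averagedLaw (J : ℕ) (F : Config → ℝ) (hF : BddMeasurable F) :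
    ∫ x, F x ∂averagedLaw L J = ((L ^ J : ℕ) : ℝ)⁻¹ *
      ∑ r ∈ Finset.range (L ^ J), ∫ x, F (shift r x) ∂blockLaw L J := by
  rw [averagedLaw, integral_smul_measure, integral_finsetSum_measure]
  · simp only [ENNReal.toReal_inv, ENNReal.toReal_natCast, smul_eq_mul]
    congr 1
    refine Finset.sum_congr rfl fun r _ => ?_
    rw [integral_map (measurable_shift r).aemeasurable hF.measurable.aestronglyMeasurable]
  · intro r _
    have := isProbabilityMeasure_map_shift L J r
    exact hF.integrable _

/-- `averagedLaw` as a probability measure. -/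
noncomputable def averagedProb (J : ℕ) : ProbabilityMeasure Config :=
  ⟨averagedLaw L J, isProbabilityMeasure_averagedLaw L J⟩

/-- Probability measures on the compact space `Config` form a compact space, so a limit exists along
any ultrafilter. -/
lemma exists_limit : ∃ (U : Filter ℕ) (_ : U.NeBot) (P : ProbabilityMeasure Config), U ≤ atTop ∧
    Tendsto (averagedProb L) U (𝓝 P) := by
  obtain ⟨P, -, hP⟩ := isCompact_univ.ultrafilter_le_nhds
    ((hyperfilter ℕ).map (averagedProb L))
    (by simp)
  exact ⟨hyperfilter ℕ, inferInstance, P, hyperfilter_le_cofinite.trans Nat.cofinite_eq_atTop.le, hP⟩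

/-- A stationary law on configurations, obtained as a limit point of the averaged laws. -/
noncomputable def stationaryLaw : Measure Config := (exists_limit L).choose_spec.choose_spec.choose

instance isProbabilityMeasure_stationaryLaw : IsProbabilityMeasure (stationaryLaw L) := by
  unfold stationaryLaw; infer_instance

lemma bddMeasurable_of_continuous {F : Config → ℝ} (hF : Continuous F) : BddMeasurable F := by
  obtain ⟨C, hC⟩ := isCompact_univ.exists_bound_of_continuousOn hF.continuousOn
  exact ⟨hF.measurable, C, fun x => hC x (Set.mem_univ x)⟩

lemma exists_filter_tendsto_integral : ∃ (U : Filter ℕ) (_ : U.NeBot), U ≤ atTop ∧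
    ∀ F : Config → ℝ, Continuous F →
      Tendsto (fun J => ∫ x, F x ∂averagedLaw L J) U (𝓝 (∫ x, F x ∂stationaryLaw L)) := by
  refine ⟨(exists_limit L).choose, (exists_limit L).choose_spec.choose, ?_⟩
  obtain ⟨h1, h2⟩ := (exists_limit L).choose_spec.choose_spec.choose_spec
  refine ⟨h1, fun F hF => ?_⟩
  exact ProbabilityMeasure.tendsto_iff_forall_integral_tendsto.1 h2
    (BoundedContinuousFunction.mkOfCompact ⟨F, hF⟩)

/-- Upper bounds for the windows inside the blocks pass to the limit law. -/
lemma integral_stationaryLaw_le (hL2 : 2 ≤ L) (F : Config → ℝ) (hF : Continuous F) (c : ℝ) (n : ℕ)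
    (h : ∀ J r : ℕ, r + 1 + n ≤ L ^ J → ∫ x, F (shift r x) ∂blockLaw L J ≤ c) :
    ∫ x, F x ∂stationaryLaw L ≤ c := by
  obtain ⟨U, hU, hle, ht⟩ := exists_filter_tendsto_integral L
  obtain ⟨B, hB⟩ := (bddMeasurable_of_continuous hF).bdd
  have hb := bddMeasurable_of_continuous hF
  have hB0 : 0 ≤ B := (abs_nonneg _).trans (hB fun _ => ⟨0, by constructor <;> simp⟩)
  have hbound : ∀ J, ∫ x, F x ∂averagedLaw L J ≤ c + ((L ^ J : ℕ) : ℝ)⁻¹ * (n * (B + |c|)) := by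
    intro J
    have hpos : (0 : ℝ) < ((L ^ J : ℕ) : ℝ) := by
      exact_mod_cast pow_pos (Nat.pos_of_ne_zero (NeZero.ne L)) J
    -- At most `n` of the `L ^ J` translates have a window that leaves the block; the crude bound
    -- for them costs `n (B + |c|) / L ^ J`, which tends to zero.
    have hr : ∀ r ∈ Finset.range (L ^ J), ∫ x, F (shift r x) ∂blockLaw L J ≤
        c + if L ^ J < r + 1 + n then B + |c| else 0 := by
      intro r _
      split_ifs with hr
      · have h1 : ∫ x, F (shift r x) ∂blockLaw L J ≤ ∫ _, B ∂blockLaw L J :=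
          integral_mono ((hb.comp (measurable_shift r)).integrable _) (integrable_const _)
            fun x => (le_abs_self _).trans (hB _)
        simp only [integral_const, probReal_univ, smul_eq_mul, one_mul] at h1
        linarith [neg_abs_le c]
      · rw [add_zero]; exact h J r (by omega)
    have hcard : (((Finset.range (L ^ J)).filter fun r => L ^ J < r + 1 + n).card : ℝ) ≤ n := by
      have : (Finset.range (L ^ J)).filter (fun r => L ^ J < r + 1 + n) ⊆
          Finset.Ico (L ^ J - n) (L ^ J) := fun r hr => by
        simp only [Finset.mem_filter, Finset.mem_range, Finset.mem_Ico] at hr ⊢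
        omega
      have h2 := Finset.card_le_card this
      rw [Nat.card_Ico] at h2
      exact_mod_cast h2.trans (by omega)
    rw [integral_averagedLaw L J F hb]
    calc ((L ^ J : ℕ) : ℝ)⁻¹ * ∑ r ∈ Finset.range (L ^ J), ∫ x, F (shift r x) ∂blockLaw L J
        ≤ ((L ^ J : ℕ) : ℝ)⁻¹ * ∑ r ∈ Finset.range (L ^ J),
          (c + if L ^ J < r + 1 + n then B + |c| else 0) := by
          gcongr with r hr'
          exact hr r hr'
      _ = c + ((L ^ J : ℕ) : ℝ)⁻¹ *
          (((Finset.range (L ^ J)).filter fun r => L ^ J < r + 1 + n).card * (B + |c|)) := by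
          rw [Finset.sum_add_distrib, ← Finset.sum_filter, Finset.sum_const, Finset.sum_const,
            Finset.card_range, nsmul_eq_mul, nsmul_eq_mul, mul_add, inv_mul_cancel_left₀ hpos.ne']
      _ ≤ _ := by gcongr
  have hlim : Tendsto (fun J => c + ((L ^ J : ℕ) : ℝ)⁻¹ * (n * (B + |c|))) U (𝓝 c) := by
    simpa using ((tendsto_inv_pow_mul_const L hL2 (n * (B + |c|))).mono_left hle).const_add c
  exact le_of_tendsto_of_tendsto' (ht F hF) hlim hbound

lemma le_integral_stationaryLaw (hL2 : 2 ≤ L) (F : Config → ℝ) (hF : Continuous F) (c : ℝ) (n : ℕ)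
    (h : ∀ J r : ℕ, r + 1 + n ≤ L ^ J → c ≤ ∫ x, F (shift r x) ∂blockLaw L J) :
    c ≤ ∫ x, F x ∂stationaryLaw L := by
  have := integral_stationaryLaw_le L hL2 (fun x => -F x) hF.neg (-c) n fun J r hr => by
    rw [integral_neg]; exact neg_le_neg (h J r hr)
  rw [integral_neg] at this
  linarith

lemma integral_stationaryLaw_eq (hL2 : 2 ≤ L) (F : Config → ℝ) (hF : Continuous F) (c : ℝ) (n : ℕ)
    (h : ∀ J r : ℕ, r + 1 + n ≤ L ^ J → ∫ x, F (shift r x) ∂blockLaw L J = c) :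
    ∫ x, F x ∂stationaryLaw L = c :=
  le_antisymm (integral_stationaryLaw_le L hL2 F hF c n fun J r hr => (h J r hr).le)
    (le_integral_stationaryLaw L hL2 F hF c n fun J r hr => (h J r hr).ge)

lemma shift_shift (r s : ℤ) (x : Config) : shift r (shift s x) = shift (r + s) x := by
  ext k; simp [shift, add_assoc]

/-- Shifting an average of translates telescopes: only the two end translates survive, and they are
divided by `L ^ J`. -/
lemma map_shift_one_stationaryLaw (hL2 : 2 ≤ L) : (stationaryLaw L).map (shift 1) = stationaryLaw L := by
  have hp : IsProbabilityMeasure ((stationaryLaw L).map (shift 1)) :=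
    Measure.isProbabilityMeasure_map (measurable_shift 1).aemeasurable
  refine ext_of_forall_integral_eq_of_IsFiniteMeasure fun F => ?_
  rw [integral_map (measurable_shift 1).aemeasurable F.continuous.measurable.aestronglyMeasurable]
  obtain ⟨U, hU, hle, ht⟩ := exists_filter_tendsto_integral L
  have hb := bddMeasurable_of_continuous F.continuous
  obtain ⟨B, hB⟩ := hb.bdd
  have hdiff : ∀ J, |∫ x, F (shift 1 x) ∂averagedLaw L J - ∫ x, F x ∂averagedLaw L J| ≤
      ((L ^ J : ℕ) : ℝ)⁻¹ * (B + B) := by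
    intro J
    have hle : ∀ r : ℤ, |∫ x, F (shift r x) ∂blockLaw L J| ≤ B := fun r => by
      have := norm_integral_le_of_norm_le_const (μ := blockLaw L J)
        (f := fun x => F (shift r x)) (C := B) (Eventually.of_forall fun x => hB _)
      simpa using this
    rw [integral_averagedLaw L J _ (hb.comp (measurable_shift 1)), integral_averagedLaw L J _ hb,
      ← mul_sub, ← Finset.sum_sub_distrib, abs_mul, abs_of_nonneg (by positivity)]
    gcongr
    have htel := Finset.sum_range_sub (fun r : ℕ => ∫ x, F (shift r x) ∂blockLaw L J) (L ^ J)
    have : ∀ r : ℕ, ∀ x, shift 1 (shift r x) = shift ((r + 1 : ℕ) : ℤ) x := fun r x => by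
      rw [shift_shift]; congr 1; push_cast; ring
    simp only [this]
    rw [htel]
    exact (abs_sub _ _).trans (add_le_add (hle _) (hle _))
  have h0 := tendsto_of_tendsto_of_tendsto_of_le_of_le' tendsto_const_nhds
    ((tendsto_inv_pow_mul_const L hL2 (B + B)).mono_left hle)
    (Eventually.of_forall fun J => abs_nonneg _) (Eventually.of_forall hdiff)
  have h1 := ((ht _ (F.continuous.comp (continuous_shift 1))).sub (ht _ F.continuous)).abs
  have := tendsto_nhds_unique h1 h0
  exact sub_eq_zero.1 (abs_eq_zero.1 this)

lemma map_shift_stationaryLaw (hL2 : 2 ≤ L) (r : ℤ) : (stationaryLaw L).map (shift r) = stationaryLaw L := by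
  have hadd : ∀ r s : ℤ, ((stationaryLaw L).map (shift s)).map (shift r) =
      (stationaryLaw L).map (shift (r + s)) := fun r s => by
    rw [Measure.map_map (measurable_shift r) (measurable_shift s)]
    congr 1
    ext1 x
    exact shift_shift r s x
  have h0 : (stationaryLaw L).map (shift 0) = stationaryLaw L := by
    have : shift 0 = id := by ext x k; simp [shift]
    rw [this, Measure.map_id]
  have hneg : (stationaryLaw L).map (shift (-1)) = stationaryLaw L := by
    have := hadd (-1) 1
    rw [map_shift_one_stationaryLaw L hL2] at this
    simpa [h0] using this
  induction r with
  | zero => exact h0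
  | succ n ih => rw [add_comm, ← hadd, ih, map_shift_one_stationaryLaw L hL2]
  | pred n ih => rw [sub_eq_add_neg, add_comm, ← hadd, ih, hneg]

lemma map_coords_blockLaw_eq {α E : Type*} [Fintype α] [MeasurableSpace E] (J : ℕ) (φ : Spin → E)
    (hφ : Measurable φ) (τ : α → ℤ) (h : Fintype.card α < L ∨ ∀ s, φ s.flip = φ s) :
    (blockLaw L J).map (fun x a => φ (x (τ a))) = iidLaw.map fun x a => φ (x (τ a)) := by
  have hm : Measurable fun (x : Config) (a : α) => φ (x (τ a)) :=
    measurable_pi_lambda _ fun a => hφ.comp (measurable_pi_apply _)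
  have h1 := Measure.isProbabilityMeasure_map (μ := blockLaw L J) hm.aemeasurable
  have h2 := Measure.isProbabilityMeasure_map (μ := iidLaw) hm.aemeasurable
  refine measure_pi_ext_of_integral_prod fun f hf => ?_
  have hfm : Measurable fun y : α → E => ∏ a, f a (y a) :=
    Finset.measurable_prod _ fun a _ => (hf a).measurable.comp (measurable_pi_apply a)
  rw [integral_map hm.aemeasurable hfm.aestronglyMeasurable,
    integral_map hm.aemeasurable hfm.aestronglyMeasurable]
  exact integral_blockLaw_prod_eq L J Finset.univ (fun a s => f a (φ s))
    (fun a => (hf a).comp hφ) τ (h.imp (fun h => h) fun h a _ s => by rw [h s])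

/-- Under the limit law, fewer than `L` coordinates have the same joint law as in the i.i.d. case,
and so do arbitrarily many coordinates up to sign. -/
lemma map_coords_stationaryLaw_eq {α E : Type*} [Fintype α] [TopologicalSpace E] [MeasurableSpace E]
    [BorelSpace E] [SecondCountableTopology E] [HasOuterApproxClosed (α → E)]
    (hL2 : 2 ≤ L) (φ : Spin → E) (hφ : Continuous φ)
    (τ : α → ℤ) (h : Fintype.card α < L ∨ ∀ s, φ s.flip = φ s) :
    (stationaryLaw L).map (fun x a => φ (x (τ a))) = iidLaw.map fun x a => φ (x (τ a)) := by
  have hc : ∀ τ : α → ℤ, Continuous fun (x : Config) (a : α) => φ (x (τ a)) := fun τ =>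
    continuous_pi fun a => hφ.comp (continuous_apply _)
  have h1 := Measure.isProbabilityMeasure_map (μ := stationaryLaw L) (hc τ).measurable.aemeasurable
  have h2 := Measure.isProbabilityMeasure_map (μ := iidLaw) (hc τ).measurable.aemeasurable
  refine ext_of_forall_integral_eq_of_IsFiniteMeasure fun f => ?_
  have hf := f.continuous.measurable.aestronglyMeasurable (μ := (stationaryLaw L).map
    fun x a => φ (x (τ a)))
  rw [integral_map (hc τ).measurable.aemeasurable hf,
    integral_map (hc τ).measurable.aemeasurable f.continuous.measurable.aestronglyMeasurable]
  refine integral_stationaryLaw_eq L hL2 _ (f.continuous.comp (hc τ)) _ 0 fun J r _ => ?_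
  rw [← integral_shift_iidLaw r (fun x => f fun a => φ (x (τ a)))
    (f.continuous.comp (hc τ)).measurable]
  have hlaw := map_coords_blockLaw_eq L J φ hφ.measurable (fun a => τ a + r) h
  have := congrArg (fun m => ∫ y, f y ∂m) hlaw
  rw [integral_map (hc _).measurable.aemeasurable f.continuous.measurable.aestronglyMeasurable,
    integral_map (hc _).measurable.aemeasurable f.continuous.measurable.aestronglyMeasurable] at this
  exact this

end blockLaw

/-! ### Tightness and convergence of moments from a `cosh` bound. -/

/-- A uniform exponential moment bound for laws on the real line. -/
def CoshBounded (ρ : Measure ℝ) : Prop := ∫⁻ x, ENNReal.ofReal (Real.cosh (x / 4)) ∂ρ ≤ 2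

namespace CoshBounded

variable {ρ : Measure ℝ}

lemma integrable_cosh (h : CoshBounded ρ) : Integrable (fun x => Real.cosh (x / 4)) ρ := by
  refine ⟨by fun_prop, ?_⟩
  rw [hasFiniteIntegral_iff_ofReal (Eventually.of_forall fun x => (Real.cosh_pos _).le)]
  exact lt_of_le_of_lt h (by simp)

lemma integral_cosh_le (h : CoshBounded ρ) : ∫ x, Real.cosh (x / 4) ∂ρ ≤ 2 := by
  rw [integral_eq_lintegral_of_nonneg_ae (Eventually.of_forall fun x => (Real.cosh_pos _).le)
    (by fun_prop)]
  exact ENNReal.toReal_le_of_le_ofReal (by norm_num) (by rw [ENNReal.ofReal_ofNat]; exact h)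

lemma abs_pow_le (x : ℝ) (q : ℕ) :
    |x| ^ q ≤ 4 ^ q * (2 * q.factorial) * Real.cosh (x / 4) := by
  have := pow_le_factorial_mul_cosh (x / 4) q
  rw [abs_div, div_pow, div_le_iff₀ (by positivity)] at this
  norm_num at this
  linarith

lemma integrable_pow (h : CoshBounded ρ) (q : ℕ) : Integrable (fun x => x ^ q) ρ := by
  refine (h.integrable_cosh.const_mul (4 ^ q * (2 * q.factorial))).mono' (by fun_prop)
    (Eventually.of_forall fun x => ?_)
  rw [Real.norm_eq_abs, abs_pow]
  exact abs_pow_le x q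

/-- Truncation only acts where `|x| > R`, and there `|x| ^ q ≤ |x| ^ (q + 1) / R`. The rate `1 / R`
is uniform over all laws with the `cosh` bound. -/
lemma abs_pow_sub_truncation_le (x R : ℝ) (hR : 0 < R) (q : ℕ) :
    |x ^ q - (max (-R) (min x R)) ^ q| ≤
      2 * (4 ^ (q + 1) * (2 * (q + 1).factorial)) / R * Real.cosh (x / 4) := by
  rcases le_or_gt |x| R with hx | hx
  · obtain ⟨h1, h2⟩ := abs_le.1 hx
    rw [min_eq_left h2, max_eq_right h1, sub_self, abs_zero]
    have := Real.cosh_pos (x / 4)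
    positivity
  · have h1 : |max (-R) (min x R)| ≤ |x| := by
      refine le_trans (abs_le.2 ⟨le_max_left _ _, max_le (by linarith) (min_le_right _ _)⟩) hx.le
    have h2 : |x ^ q - (max (-R) (min x R)) ^ q| ≤ 2 * |x| ^ q := by
      refine (abs_sub _ _).trans ?_
      rw [abs_pow, abs_pow]
      linarith [pow_le_pow_left₀ (abs_nonneg _) h1 q]
    refine h2.trans ?_
    rw [div_mul_eq_mul_div, le_div_iff₀ hR]
    have h3 := abs_pow_le x (q + 1)
    have h4 : |x| ^ q * R ≤ |x| ^ (q + 1) := by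
      rw [pow_succ]; exact mul_le_mul_of_nonneg_left hx.le (by positivity)
    linarith

/-- The bounded continuous truncation of the power function. -/
noncomputable def truncPow (R : ℝ) (q : ℕ) : ℝ →ᵇ ℝ :=
  BoundedContinuousFunction.ofNormedAddCommGroup (fun x : ℝ => (max (-|R|) (min x |R|)) ^ q)
    (by fun_prop) (|R| ^ q) fun x => by
      rw [Real.norm_eq_abs, abs_pow]
      exact pow_le_pow_left₀ (abs_nonneg _) (abs_le.2 ⟨le_max_left _ _,
        max_le (by linarith [abs_nonneg R]) (min_le_right _ _)⟩) q

lemma abs_integral_pow_sub_le [IsProbabilityMeasure ρ] (h : CoshBounded ρ) (R : ℝ) (hR : 0 < R)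
    (q : ℕ) : |∫ x, x ^ q ∂ρ - ∫ x, truncPow R q x ∂ρ| ≤
      4 * (4 ^ (q + 1) * (2 * (q + 1).factorial)) / R := by
  have hbound : ∀ x, ‖x ^ q - truncPow R q x‖ ≤
      2 * (4 ^ (q + 1) * (2 * (q + 1).factorial)) / R * Real.cosh (x / 4) := fun x => by
    have := abs_pow_sub_truncation_le x R hR q
    rw [Real.norm_eq_abs]
    simpa [truncPow, abs_of_pos hR] using this
  rw [← integral_sub (h.integrable_pow q) ((truncPow R q).integrable ρ), ← Real.norm_eq_abs]
  calc ‖∫ x, (x ^ q - truncPow R q x) ∂ρ‖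
      ≤ ∫ x, 2 * (4 ^ (q + 1) * (2 * (q + 1).factorial)) / R * Real.cosh (x / 4) ∂ρ :=
        norm_integral_le_of_norm_le (h.integrable_cosh.const_mul _) (Eventually.of_forall hbound)
    _ = 2 * (4 ^ (q + 1) * (2 * (q + 1).factorial)) / R * ∫ x, Real.cosh (x / 4) ∂ρ :=
        integral_const_mul _ _
    _ ≤ 2 * (4 ^ (q + 1) * (2 * (q + 1).factorial)) / R * 2 := by
        gcongr; exact h.integral_cosh_le
    _ = _ := by ring

/-- Lower semicontinuity of the lower integral under weak convergence, through open sets; no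
integrability of the limit has to be known beforehand. -/
lemma of_tendsto {ρ : ℕ → ProbabilityMeasure ℝ} {μ : ProbabilityMeasure ℝ}
    (h : ∀ n, CoshBounded (ρ n)) (ht : Tendsto ρ atTop (𝓝 μ)) : CoshBounded (μ : Measure ℝ) := by
  have := lintegral_le_liminf_lintegral_of_forall_isOpen_measure_le_liminf_measure
    (μ := (μ : Measure ℝ)) (μs := fun n => (ρ n : Measure ℝ))
    (f := fun x => Real.cosh (x / 4)) (by fun_prop) (fun x => (Real.cosh_pos _).le)
    fun G hG => ProbabilityMeasure.le_liminf_measure_open_of_tendsto ht hG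
  exact this.trans (liminf_le_of_le (by isBoundedDefault) fun b hb =>
    (hb.exists.choose_spec).trans (h _))

lemma tendsto_integral_pow {ρ : ℕ → ProbabilityMeasure ℝ} {μ : ProbabilityMeasure ℝ}
    (h : ∀ n, CoshBounded (ρ n)) (ht : Tendsto ρ atTop (𝓝 μ)) (q : ℕ) :
    Tendsto (fun n => ∫ x, x ^ q ∂(ρ n : Measure ℝ)) atTop (𝓝 (∫ x, x ^ q ∂(μ : Measure ℝ))) := by
  have hμ := of_tendsto h ht
  rw [Metric.tendsto_atTop]
  intro ε hε
  set C : ℝ := 4 * (4 ^ (q + 1) * (2 * (q + 1).factorial)) with hC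
  have hCpos : 0 < C := by positivity
  -- This radius makes each of the two truncation errors `ε / 3`; the truncated integrals differ by
  -- less than `ε / 4`.
  have hR : 0 < 3 * C / ε := by positivity
  have hCR : C / (3 * C / ε) = ε / 3 := by field_simp
  obtain ⟨n₀, hn₀⟩ := Metric.tendsto_atTop.1
    (ProbabilityMeasure.tendsto_iff_forall_integral_tendsto.1 ht (truncPow (3 * C / ε) q))
    (ε / 4) (by positivity)
  refine ⟨n₀, fun n hn => ?_⟩
  have h1 := (h n).abs_integral_pow_sub_le _ hR q
  have h2 := hμ.abs_integral_pow_sub_le _ hR q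
  have h3 := hn₀ n hn
  rw [← hC, hCR] at h1 h2
  rw [Real.dist_eq] at h3 ⊢
  have h1' := abs_le.1 h1
  have h2' := abs_le.1 h2
  have h3' := abs_lt.1 h3
  exact abs_lt.2 ⟨by linarith [h1'.1, h2'.2, h3'.1], by linarith [h1'.2, h2'.1, h3'.2]⟩

lemma isTightMeasureSet {S : Set (Measure ℝ)} (hS : ∀ ρ ∈ S, IsProbabilityMeasure ρ)
    (h : ∀ ρ ∈ S, CoshBounded ρ) : IsTightMeasureSet S := by
  refine isTightMeasureSet_of_tendsto_measure_norm_gt ?_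
  have hlim : Tendsto (fun r : ℝ => ENNReal.ofReal (16 / r)) atTop (𝓝 0) := by
    rw [← ENNReal.ofReal_zero]
    exact ENNReal.tendsto_ofReal (tendsto_const_nhds.div_atTop tendsto_id)
  refine tendsto_of_tendsto_of_tendsto_of_le_of_le' tendsto_const_nhds hlim
    (Eventually.of_forall fun _ => zero_le) ?_
  filter_upwards [eventually_gt_atTop 0] with r hr
  refine iSup₂_le fun ρ hρ => ?_
  have hp := hS ρ hρ
  have hc := h ρ hρ
  have hint : Integrable (fun x : ℝ => |x|) ρ := by
    have := (hc.integrable_pow 1).abs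
    simpa using this
  have h1 : r * ρ.real {x | r ≤ |x|} ≤ ∫ x, |x| ∂ρ :=
    mul_meas_ge_le_integral_of_nonneg (Eventually.of_forall fun x => abs_nonneg _) hint r
  have h2 : ∫ x, |x| ∂ρ ≤ 16 := by
    calc ∫ x, |x| ∂ρ ≤ ∫ x, 8 * Real.cosh (x / 4) ∂ρ :=
          integral_mono hint (hc.integrable_cosh.const_mul _) fun x => by
            have := abs_pow_le x 1
            norm_num at this
            exact this
      _ ≤ 16 := by rw [integral_const_mul]; linarith [hc.integral_cosh_le]
  calc ρ {x | r < ‖x‖} ≤ ρ {x | r ≤ |x|} := 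
        measure_mono fun x (hx : r < ‖x‖) => (show r ≤ |x| from le_of_lt hx)
    _ = ENNReal.ofReal (ρ.real {x | r ≤ |x|}) := (ofReal_measureReal).symm
    _ ≤ ENNReal.ofReal (16 / r) := by
      refine ENNReal.ofReal_le_ofReal ?_
      rw [le_div_iff₀ hr]
      linarith

lemma exists_subseq_tendsto (ρ : ℕ → ProbabilityMeasure ℝ) (h : ∀ n, CoshBounded (ρ n)) :
    ∃ (μ : ProbabilityMeasure ℝ) (φ : ℕ → ℕ), StrictMono φ ∧ Tendsto (ρ ∘ φ) atTop (𝓝 μ) := by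
  have ht : IsCompact (closure (Set.range ρ)) := by
    refine isCompact_closure_of_isTightMeasureSet (isTightMeasureSet ?_ ?_)
    · rintro _ ⟨μ, -, rfl⟩; infer_instance
    · rintro _ ⟨_, ⟨n, rfl⟩, rfl⟩; exact h n
  obtain ⟨μ, -, φ, hφ, hlim⟩ := ht.tendsto_subseq fun n => subset_closure (Set.mem_range_self n)
  exact ⟨μ, φ, hφ, hlim⟩

end CoshBounded

/-! ### Convergence of types towards the normal law. -/

lemma map_atTop_of_strictMono {f : ℕ → ℕ} (hf : StrictMono f) :
    map f atTop = atTop ⊓ 𝓟 (Set.range f) := by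
  have : comap f atTop = atTop :=
    comap_embedding_atTop (fun _ _ => hf.le_iff_le) fun c => ⟨c, hf.id_le c⟩
  rw [← map_comap, this]

/-- If `μ` is a limit in law of `Y` and the affine images `α Y + β` with `α ≥ 0` converge in law to
the standard normal law, then `μ` is normal. -/
lemma exists_eq_gaussianReal_of_tendsto {Ω : Type*} [MeasurableSpace Ω] (P : Measure Ω)
    [IsProbabilityMeasure P] (Y : ℕ → Ω → ℝ) (α β : ℕ → ℝ) (hα : ∀ n, 0 ≤ α n)
    (μ : Measure ℝ) [IsProbabilityMeasure μ]
    (hY : TendstoInDistribution Y atTop (id : ℝ → ℝ) (fun _ => P) μ)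
    (hZ : TendstoInDistribution (fun n ω => α n * Y n ω + β n) atTop (id : ℝ → ℝ) (fun _ => P)
      (gaussianReal 0 1)) : ∃ m v, μ = gaussianReal m v := by
  -- No bound on `α` and `β` is available. Dividing by `M` makes the triple `(α, β, 1) / M` range in
  -- a compact set, and its limit points satisfy `p + |q| + r = 1`. In the limit, `p Y + q` and `r
  -- Z` have the same law.
  let M : ℕ → ℝ := fun n => α n + |β n| + 1
  have hM : ∀ n, 0 < M n := fun n => by have := hα n; positivity
  let w : ℕ → ℝ × ℝ × ℝ := fun n => (α n / M n, β n / M n, 1 / M n)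
  have hw : ∀ n, w n ∈ Set.Icc (0 : ℝ) 1 ×ˢ Set.Icc (-1 : ℝ) 1 ×ˢ Set.Icc (0 : ℝ) 1 := fun n => by
    have h1 := hα n
    have h2 := abs_nonneg (β n)
    have h3 := hM n
    refine ⟨⟨by positivity, (div_le_one h3).2 (by simp only [M]; linarith)⟩, ?_, ⟨by positivity,
      (div_le_one h3).2 (by simp only [M]; linarith)⟩⟩
    refine abs_le.1 ?_
    change |β n / M n| ≤ 1
    rw [abs_div, abs_of_pos h3]
    exact (div_le_one h3).2 (by simp only [M]; linarith)
  obtain ⟨⟨p, q, r⟩, hpqr, ψ, hψ, hlim⟩ :=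
    (isCompact_Icc.prod (isCompact_Icc.prod isCompact_Icc)).tendsto_subseq hw
  have hp : Tendsto (fun n => α (ψ n) / M (ψ n)) atTop (𝓝 p) :=
    (continuous_fst.tendsto _).comp hlim
  have hq : Tendsto (fun n => β (ψ n) / M (ψ n)) atTop (𝓝 q) :=
    ((continuous_fst.comp continuous_snd).tendsto _).comp hlim
  have hr : Tendsto (fun n => 1 / M (ψ n)) atTop (𝓝 r) :=
    ((continuous_snd.comp continuous_snd).tendsto _).comp hlim
  have hsum : p + |q| + r = 1 := by
    have h1 := (hp.add hq.abs).add hr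
    refine tendsto_nhds_unique h1 (tendsto_const_nhds.congr fun n => ?_)
    have := hM (ψ n)
    rw [abs_div, abs_of_pos this]
    field_simp
    simp [M]
  have hYψ : TendstoInDistribution (fun n => Y (ψ n)) atTop (id : ℝ → ℝ) (fun _ => P) μ :=
    ⟨fun n => hY.forall_aemeasurable _, hY.aemeasurable_limit, hY.tendsto.comp hψ.tendsto_atTop⟩
  have hZψ : TendstoInDistribution (fun n ω => α (ψ n) * Y (ψ n) ω + β (ψ n)) atTop (id : ℝ → ℝ)
      (fun _ => P) (gaussianReal 0 1) :=
    ⟨fun n => hZ.forall_aemeasurable _, hZ.aemeasurable_limit, hZ.tendsto.comp hψ.tendsto_atTop⟩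
  have hpq : TendstoInMeasure P (fun n (_ : Ω) => (α (ψ n) / M (ψ n), β (ψ n) / M (ψ n))) atTop
      fun _ => (p, q) :=
    tendstoInMeasure_of_tendsto_ae (fun n => aestronglyMeasurable_const)
      (Eventually.of_forall fun _ => hp.prodMk_nhds hq)
  have hr' : TendstoInMeasure P (fun n (_ : Ω) => 1 / M (ψ n)) atTop fun _ => r :=
    tendstoInMeasure_of_tendsto_ae (fun n => aestronglyMeasurable_const)
      (Eventually.of_forall fun _ => hr)
  have h1 := hYψ.continuous_comp_prodMk_of_tendstoInMeasure_const
    (g := fun z : ℝ × ℝ × ℝ => z.2.1 * z.1 + z.2.2) (by fun_prop) hpq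
    (fun n => aemeasurable_const)
  have h2 := hZψ.continuous_comp_prodMk_of_tendstoInMeasure_const
    (g := fun z : ℝ × ℝ => z.2 * z.1) (by fun_prop) hr' (fun n => aemeasurable_const)
  have heq : (fun n ω => 1 / M (ψ n) * (α (ψ n) * Y (ψ n) ω + β (ψ n))) =
      fun n ω => α (ψ n) / M (ψ n) * Y (ψ n) ω + β (ψ n) / M (ψ n) := by
    ext n ω
    have := (hM (ψ n)).ne'
    field_simp
  simp only [heq] at h2
  have key := tendstoInDistribution_unique _ h1 h2
  simp only [id] at key
  rw [gaussianReal_map_const_mul] at key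
  -- If `p = 0`, the constant `q` has law `N(0, r²)`, so `q = r = 0`, against `p + |q| + r = 1`. If
  -- `p > 0`, the affine map can be inverted.
  rcases eq_or_lt_of_le hpqr.1.1 with h0 | h0
  · subst h0
    simp only [zero_mul, zero_add, Measure.map_const, measure_univ, one_smul,
      ← gaussianReal_zero_var] at key
    obtain ⟨h3, h4⟩ := gaussianReal_ext_iff.1 key
    have h5 : r ^ 2 = 0 := by
      have := congrArg NNReal.toReal h4
      simpa using this.symm
    have h6 : r = 0 := by simpa using h5
    rw [mul_zero] at h3
    rw [h3, h6] at hsum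
    norm_num at hsum
  · have h3 := congrArg (fun m : Measure ℝ => (m.map (· - q)).map (· / p)) key
    rw [gaussianReal_map_sub_const, gaussianReal_map_div_const,
      Measure.map_map (by fun_prop) (by fun_prop), Measure.map_map (by fun_prop) (by fun_prop)] at h3
    have h4 : ((fun x => x / p) ∘ (fun x => x - q)) ∘ (fun x : ℝ => p * x + q) = id := by
      ext x
      simp only [Function.comp_apply, id]
      field_simp
      ring
    rw [Function.comp_assoc] at h3 h4
    rw [h4, Measure.map_id] at h3
    exact ⟨_, _, h3⟩

/-! ### Normalized sums and their non-normal limits. -/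

lemma measurable_coe_coord (k : ℤ) : Measurable fun x : Config => (x k : ℝ) :=
  measurable_subtype_coe.comp (measurable_pi_apply k)

/-- The law of `S_n / √n` under a law on configurations. -/
noncomputable def normalizedLaw (P : Measure Config) [IsProbabilityMeasure P] (n : ℕ) :
    ProbabilityMeasure ℝ :=
  ⟨P.map fun x => startSum n x / √n, Measure.isProbabilityMeasure_map
    ((continuous_startSum n).div_const _).measurable.aemeasurable⟩

section normalizedLaw

variable {P : Measure Config} [IsProbabilityMeasure P]

lemma integral_pow_normalizedLaw (n q : ℕ) :
    ∫ y, y ^ q ∂(normalizedLaw P n : Measure ℝ) = (∫ x, startSum n x ^ q ∂P) / √n ^ q := by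
  have : ∫ y, y ^ q ∂(normalizedLaw P n : Measure ℝ) = ∫ x, (startSum n x / √n) ^ q ∂P :=
    integral_map ((continuous_startSum n).div_const _).measurable.aemeasurable (by fun_prop)
  rw [this, ← integral_div]
  simp only [div_pow]

lemma coshBounded_normalizedLaw {n : ℕ}
    (h : ∫ x, Real.cosh ((4 * √n)⁻¹ * startSum n x) ∂P ≤ 2) :
    CoshBounded (normalizedLaw P n : Measure ℝ) := by
  have h1 : ∫⁻ y, ENNReal.ofReal (Real.cosh (y / 4)) ∂(normalizedLaw P n : Measure ℝ) =
      ∫⁻ x, ENNReal.ofReal (Real.cosh (startSum n x / √n / 4)) ∂P :=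
    lintegral_map (by fun_prop) ((continuous_startSum n).div_const _).measurable
  have hint : Integrable (fun x => Real.cosh (startSum n x / √n / 4)) P :=
    (bddMeasurable_of_continuous (Real.continuous_cosh.comp
      (((continuous_startSum n).div_const _).div_const 4))).integrable P
  rw [CoshBounded, h1, ← ofReal_integral_eq_lintegral_ofReal hint
    (Eventually.of_forall fun x => (Real.cosh_pos _).le), ← ENNReal.ofReal_ofNat]
  refine ENNReal.ofReal_le_ofReal ?_
  have heq : ∀ x, startSum n x / √n / 4 = (4 * √n)⁻¹ * startSum n x := fun x => by
    rw [mul_inv, div_eq_mul_inv, div_eq_mul_inv]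
    ring
  simpa only [heq] using h

lemma tendstoInDistribution_normalizedLaw_iff {l : Filter ℕ} {ν : ℕ → ℕ} {μ : ProbabilityMeasure ℝ} :
    TendstoInDistribution (fun i x => startSum (ν i) x / √(ν i : ℝ)) l (id : ℝ → ℝ) (fun _ => P) μ ↔
      Tendsto (fun i => normalizedLaw P (ν i)) l (𝓝 μ) := by
  have hid : (⟨(μ : Measure ℝ).map id, Measure.isProbabilityMeasure_map aemeasurable_id⟩ :
      ProbabilityMeasure ℝ) = μ := Subtype.ext Measure.map_id
  refine ⟨fun h => ?_, fun h => ⟨fun i =>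
    ((continuous_startSum _).div_const _).measurable.aemeasurable, aemeasurable_id, ?_⟩⟩
  · have := h.tendsto
    rwa [hid] at this
  · rw [hid]; exact h

end normalizedLaw

lemma tendsto_normalizedLaw_iidLaw :
    Tendsto (normalizedLaw iidLaw) atTop (𝓝 ⟨gaussianReal 0 1, inferInstance⟩) := by
  have hid : ∀ k l : ℤ, IdentDistrib (fun x : Config => (x k : ℝ)) (fun x => (x l : ℝ))
      iidLaw iidLaw := fun k l => by
    refine ⟨(measurable_coe_coord k).aemeasurable, (measurable_coe_coord l).aemeasurable, ?_⟩
    have h : ∀ k : ℤ, iidLaw.map (fun x : Config => (x k : ℝ)) = spinLaw.map Subtype.val := fun k => by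
      rw [← Measure.infinitePi_map_eval (fun _ : ℤ => spinLaw) k,
        Measure.map_map measurable_subtype_coe (measurable_pi_apply k)]
      rfl
    rw [h, h]
  have hclt := tendstoInDistribution_inv_sqrt_mul_sum (P := iidLaw)
    (X := fun (k : ℕ) (x : Config) => (x ((k : ℤ) + 1) : ℝ)) (P' := gaussianReal 0 1) (Y := id)
    HasLaw.id (integral_coord_iidLaw _) (by
      have := integral_coord_mul_coord_iidLaw 1 1
      simpa [← sq] using this)
    (iIndepFun_coord_iidLaw.precomp (g := fun k : ℕ => (k : ℤ) + 1) fun a b h => by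
      simpa using h) fun i => hid _ _
  refine (tendstoInDistribution_normalizedLaw_iff (ν := id)).1 ?_
  simp only [← div_eq_inv_mul] at hclt
  exact hclt

section stationaryLaw

variable (L : ℕ) [NeZero L] [hL : Fact (Even L)]

lemma coshBounded_normalizedLaw_stationaryLaw (hL4 : 4 ≤ L) (n : ℕ) :
    CoshBounded (normalizedLaw (stationaryLaw L) n : Measure ℝ) :=
  coshBounded_normalizedLaw <| integral_stationaryLaw_le L (by omega) _
    (Real.continuous_cosh.comp ((continuous_startSum n).const_mul _)) 2 n fun J r h =>
      integral_cosh_window_le L hL4 J r n h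

lemma integral_pow_normalizedLaw_stationaryLaw_eq (hL2 : 2 ≤ L) (n q : ℕ) (hq : q < L) :
    ∫ y, y ^ q ∂(normalizedLaw (stationaryLaw L) n : Measure ℝ) =
      ∫ y, y ^ q ∂(normalizedLaw iidLaw n : Measure ℝ) := by
  rw [integral_pow_normalizedLaw, integral_pow_normalizedLaw,
    integral_stationaryLaw_eq L hL2 (fun x => startSum n x ^ q) ((continuous_startSum n).pow q) _ n fun J r h =>
      integral_window_pow_eq L J r n q hq h]

lemma integral_pow_normalizedLaw_stationaryLaw_ge (hL4 : 4 ≤ L) (n : ℕ) (hn : 2 * L ≤ n) :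
    ∫ y, y ^ L ∂(normalizedLaw iidLaw n : Measure ℝ) + (1 / (2048 * L)) ^ L ≤
      ∫ y, y ^ L ∂(normalizedLaw (stationaryLaw L) n : Measure ℝ) := by
  have h := le_integral_stationaryLaw L (by omega) _ ((continuous_startSum n).pow L) _ n
    fun J r h => window_pow_gap L hL4 J r n h hn
  have hpos : 0 < √(n : ℝ) := Real.sqrt_pos.2 (by exact_mod_cast (by omega : 0 < n))
  rw [integral_pow_normalizedLaw, integral_pow_normalizedLaw, le_div_iff₀ (by positivity), add_mul,
    div_mul_cancel₀ _ (by positivity), ← mul_pow, one_div_mul_eq_div]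
  exact h

/-- Moments of order one and two force `m = 0` and `v = 1`; the `L`-th moment then exceeds that of
`N(0,1)` by a fixed positive amount. The moments of `N(0,1)` enter as limits of those of i.i.d.
sums, so no explicit formula is needed. -/
lemma ne_gaussianReal_of_tendsto_normalizedLaw (hL4 : 4 ≤ L) {ν : ℕ → ℕ} (hν : StrictMono ν)
    {μ : ProbabilityMeasure ℝ}
    (h : Tendsto (fun i => normalizedLaw (stationaryLaw L) (ν i)) atTop (𝓝 μ)) (m : ℝ)
    (v : NNReal) : (μ : Measure ℝ) ≠ gaussianReal m v := by
  intro hμ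
  have h1 := CoshBounded.tendsto_integral_pow
    (fun i => coshBounded_normalizedLaw_stationaryLaw L hL4 (ν i)) h
  have h2 := CoshBounded.tendsto_integral_pow
    (fun i => coshBounded_normalizedLaw (integral_cosh_startSum_iidLaw_le (ν i)))
    (tendsto_normalizedLaw_iidLaw.comp hν.tendsto_atTop)
  have heq : ∀ q < L, ∫ y, y ^ q ∂gaussianReal m v = ∫ y, y ^ q ∂gaussianReal 0 1 := fun q hq => by
    rw [← hμ]
    refine tendsto_nhds_unique (h1 q) ((h2 q).congr fun i => ?_)
    exact (integral_pow_normalizedLaw_stationaryLaw_eq L (by omega) _ q hq).symm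
  have hm : m = 0 := by
    have := heq 1 (by omega)
    simpa only [pow_one, integral_id_gaussianReal] using this
  have hv : v = 1 := by
    have hsq : ∀ w : NNReal, ∫ y, y ^ 2 ∂gaussianReal 0 w = w := fun w => by
      have := variance_eq_integral (μ := gaussianReal 0 w) (X := fun x => x) (by fun_prop)
      rw [variance_fun_id_gaussianReal] at this
      simpa [integral_id_gaussianReal] using this.symm
    have := heq 2 (by omega)
    rw [hm, hsq, hsq] at this
    exact_mod_cast this
  have hle := le_of_tendsto_of_tendsto ((h2 L).add_const ((1 / (2048 * L : ℝ)) ^ L)) (h1 L) (by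
    filter_upwards [hν.tendsto_atTop.eventually_ge_atTop (2 * L)] with i hi
    exact integral_pow_normalizedLaw_stationaryLaw_ge L hL4 _ hi)
  rw [hμ, hm, hv] at hle
  have hpos : (0 : ℝ) < L := by exact_mod_cast (by omega : 0 < L)
  have : (0 : ℝ) < (1 / (2048 * L : ℝ)) ^ L := by positivity
  exact absurd hle (not_le.2 (lt_add_of_pos_right _ this))

/-- Independence is a property of the joint law, and here that law is the i.i.d. one. -/
lemma iIndepFun_comp_coord_stationaryLaw {α : Type*} [Fintype α] (hL2 : 2 ≤ L) (φ : ℝ → ℝ)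
    (hφ : Continuous φ) (τ : α → ℤ) (hτ : Function.Injective τ)
    (h : Fintype.card α < L ∨ ∀ s, φ (-s) = φ s) :
    iIndepFun (fun (a : α) (x : Config) => φ (x (τ a))) (stationaryLaw L) := by
  have hc : Continuous fun s : Spin => φ s := hφ.comp continuous_subtype_val
  have hm : ∀ k : ℤ, Measurable fun x : Config => φ (x k) := fun k =>
    hc.measurable.comp (measurable_pi_apply k)
  have hlaw := map_coords_stationaryLaw_eq L hL2 (fun s : Spin => φ s) hc τ
    (h.imp id fun h s => by rw [Spin.coe_flip, h])
  have hind : iIndepFun (fun (a : α) (x : Config) => φ (x (τ a))) iidLaw :=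
    (iIndepFun_coord_iidLaw.precomp hτ).comp (fun _ => φ) fun _ => hφ.measurable
  rw [iIndepFun_iff_map_fun_eq_pi_map fun a => (hm _).aemeasurable] at hind ⊢
  rw [hlaw, hind]
  congr 1
  ext1 a
  -- The marginals must also be carried over; they are projections of the same joint law.
  have := congrArg (fun m => m.map (fun y : α → ℝ => y a)) hlaw
  rw [Measure.map_map (measurable_pi_apply a) (measurable_pi_lambda _ fun a => hm _),
    Measure.map_map (measurable_pi_apply a) (measurable_pi_lambda _ fun a => hm _)] at this
  exact this.symm

lemma map_coord_stationaryLaw (hL2 : 2 ≤ L) (k : ℤ) :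
    (stationaryLaw L).map (fun x => x k) = spinLaw := by
  have hlaw := map_coords_stationaryLaw_eq L hL2 (fun s : Spin => s) continuous_id
    (fun _ : Unit => k) (Or.inl (by rw [Fintype.card_unit]; omega))
  have := congrArg (fun m => m.map (fun y : Unit → Spin => y ())) hlaw
  rw [Measure.map_map (measurable_pi_apply _) (by fun_prop),
    Measure.map_map (measurable_pi_apply _) (by fun_prop)] at this
  rw [← Measure.infinitePi_map_eval (fun _ : ℤ => spinLaw) k]
  exact this

lemma strictlyStationary_stationaryLaw (hL2 : 2 ≤ L) :
    StrictlyStationary (stationaryLaw L) fun (k : ℤ) (x : Config) => (x k : ℝ) := by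
  intro j l m
  have hm : ∀ j : ℤ, Measurable fun (x : Config) (i : Fin (m + 1)) => (x (j + (i : ℕ)) : ℝ) :=
    fun j => measurable_pi_lambda _ fun i => measurable_coe_coord _
  refine ⟨(hm j).aemeasurable, (hm l).aemeasurable, ?_⟩
  have h : ∀ j : ℤ, (stationaryLaw L).map (fun x (i : Fin (m + 1)) => (x (j + (i : ℕ)) : ℝ)) =
      (stationaryLaw L).map (fun x (i : Fin (m + 1)) => (x (i : ℕ) : ℝ)) := fun j => by
    conv_rhs => rw [← map_shift_stationaryLaw L hL2 j,
      Measure.map_map (measurable_pi_lambda _ fun i => measurable_coe_coord _) (measurable_shift j)]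
    congr 1
    ext x i
    simp [shift, add_comm]
  rw [h, h]

end stationaryLaw

/-! ### Assembly of the theorem. -/

lemma partialSum_coord (n : ℕ) (x : Config) :
    partialSum (fun (k : ℤ) (x : Config) => (x k : ℝ)) n x = startSum n x := by
  induction n with
  | zero => simp [partialSum, startSum]
  | succ n ih =>
    unfold partialSum startSum at *
    rw [Finset.sum_Icc_succ_top (by omega), ih, Finset.sum_range_succ]
    push_cast
    rfl

/-- A cofinal sequence in an infinite set turns convergence along the set into convergence of a
sequence. -/
lemma TendstoInLawAlong.comp {Ω : Type*} [MeasurableSpace Ω] {P : Measure Ω}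
    [IsProbabilityMeasure P] {Y : ℕ → Ω → ℝ} {T : Set ℕ} {μ : Measure ℝ} [IsProbabilityMeasure μ]
    (h : TendstoInLawAlong P Y T μ) {ν : ℕ → ℕ} (hν : StrictMono ν) (hT : ∀ i, ν i ∈ T) :
    TendstoInDistribution (fun i => Y (ν i)) atTop (id : ℝ → ℝ) (fun _ => P) μ :=
  ⟨fun _ => h.forall_aemeasurable _, h.aemeasurable_limit, h.tendsto.comp
    (tendsto_inf.2 ⟨hν.tendsto_atTop, tendsto_principal.2 (Eventually.of_forall hT)⟩)⟩

lemma exists_strictMono_mem {Q : Set ℕ} (hQ : Q.Infinite) :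
    ∃ ν : ℕ → ℕ, StrictMono ν ∧ ∀ i, ν i ∈ Q :=
  ⟨Nat.nth (· ∈ Q), Nat.nth_strictMono hQ, Nat.nth_mem_of_infinite hQ⟩

theorem theorem1p1 (N : ℕ) (hN : 2 ≤ N) :
    ∃ (Ω : Type) (_ : MeasurableSpace Ω) (P : Measure Ω) (_ : IsProbabilityMeasure P)
      (X : ℤ → Ω → ℝ),
      (∀ k, Measurable (X k)) ∧
      StrictlyStationary P X ∧
      -- `X_0` is uniform on `[-√3, √3]`, hence centred with variance one
      (pdf.IsUniform (X 0) (Set.Icc (-√3) √3) P volume ∧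
        ∫ ω, X 0 ω ∂P = 0 ∧ ∫ ω, X 0 ω ^ 2 ∂P = 1) ∧
      TuplewiseIndep P N X ∧
      -- the absolute values are independent and identically distributed
      (iIndepFun (fun (k : ℤ) ω => |X k ω|) P ∧
        ∀ j k : ℤ, IdentDistrib (fun ω => |X j ω|) (fun ω => |X k ω|) P P) ∧
      -- every subsequence has a further subsequence with a nondegenerate, non-normal limit law
      (∀ Q : Set ℕ, Q.Infinite →
        ∃ T : Set ℕ, T ⊆ Q ∧ T.Infinite ∧
          ∃ (μ : Measure ℝ) (_ : IsProbabilityMeasure μ),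
            (∀ c : ℝ, μ ≠ Measure.dirac c) ∧
            (∀ (m : ℝ) (v : NNReal), μ ≠ gaussianReal m v) ∧
            TendstoInLawAlong P (fun n ω => partialSum X n ω / √(n : ℝ)) T μ) ∧
      -- no affine normalization gives the standard normal law, even along a subsequence
      (∀ Q : Set ℕ, Q.Infinite →
        ¬ ∃ a b : ℕ → ℝ, (∀ n ∈ Q, 0 < a n) ∧
          TendstoInLawAlong P (fun n ω => a n * partialSum X n ω + b n) Q (gaussianReal 0 1)) := by
  -- `L = 2 * N` is even, at least `4`, and larger than `N`, so any `N` coordinates fall under the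
  -- comparison with the i.i.d. law.
  have : NeZero (2 * N) := ⟨by omega⟩
  have : Fact (Even (2 * N)) := ⟨even_two_mul N⟩
  have hL2 : 2 ≤ 2 * N := by omega
  have hL4 : 4 ≤ 2 * N := by omega
  have hmap : ∀ k : ℤ, (stationaryLaw (2 * N)).map (fun x : Config => (x k : ℝ)) =
      spinLaw.map Subtype.val := fun k => by
    rw [← map_coord_stationaryLaw (2 * N) hL2 k,
      Measure.map_map measurable_subtype_coe (measurable_pi_apply k)]
    rfl
  have hsub : ∀ Q : Set ℕ, Q.Infinite → ∃ ν : ℕ → ℕ, StrictMono ν ∧ (∀ i, ν i ∈ Q) ∧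
      ∃ μ : ProbabilityMeasure ℝ, (∀ (m : ℝ) (v : NNReal), (μ : Measure ℝ) ≠ gaussianReal m v) ∧
        TendstoInDistribution (fun i x => startSum (ν i) x / √(ν i : ℝ)) atTop (id : ℝ → ℝ)
          (fun _ => stationaryLaw (2 * N)) μ := fun Q hQ => by
    obtain ⟨ν, hν, hmem⟩ := exists_strictMono_mem hQ
    obtain ⟨μ, φ, hφ, hlim⟩ := CoshBounded.exists_subseq_tendsto _ fun i =>
      coshBounded_normalizedLaw_stationaryLaw (2 * N) hL4 (ν i)
    exact ⟨ν ∘ φ, hν.comp hφ, fun i => hmem _, μ,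
      ne_gaussianReal_of_tendsto_normalizedLaw (2 * N) hL4 (hν.comp hφ) hlim,
      tendstoInDistribution_normalizedLaw_iff.2 hlim⟩
  refine ⟨Config, inferInstance, stationaryLaw (2 * N), inferInstance, fun k x => (x k : ℝ),
    measurable_coe_coord, strictlyStationary_stationaryLaw _ hL2, ⟨?_, ?_, ?_⟩, ?_, ⟨?_, ?_⟩, ?_, ?_⟩
  · exact (hmap 0).trans map_val_spinLaw
  · rw [← integral_spin, ← map_coord_stationaryLaw (2 * N) hL2 0,
      integral_map (measurable_pi_apply 0).aemeasurable (by measurability)]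
  · rw [← integral_spin_sq, ← map_coord_stationaryLaw (2 * N) hL2 0,
      integral_map (measurable_pi_apply 0).aemeasurable (by measurability)]
  · intro k hk
    exact iIndepFun_comp_coord_stationaryLaw (2 * N) hL2 id continuous_id k hk
      (Or.inl (by rw [Fintype.card_fin]; omega))
  · exact iIndepFun_iff_finset.2 fun s => iIndepFun_comp_coord_stationaryLaw (2 * N) hL2 (|·|)
      continuous_abs (fun k : s => (k : ℤ)) Subtype.val_injective (Or.inr abs_neg)
  · intro j k
    have : IdentDistrib (fun x : Config => (x j : ℝ)) (fun x => (x k : ℝ)) (stationaryLaw (2 * N))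
      (stationaryLaw (2 * N)) := 
      ⟨(measurable_coe_coord j).aemeasurable, (measurable_coe_coord k).aemeasurable,
        by rw [hmap, hmap]⟩
    exact this.comp continuous_abs.measurable
  · intro Q hQ
    obtain ⟨ν, hν, hmem, μ, hμ, hlim⟩ := hsub Q hQ
    -- A point mass is a normal law of variance zero, so nondegeneracy is a case of non-normality.
    refine ⟨Set.range ν, Set.range_subset_iff.2 hmem, Set.infinite_range_of_injective hν.injective,
      μ, inferInstance, fun c h => hμ c 0 (by rw [gaussianReal_zero_var, h]), hμ, ?_⟩
    simp only [partialSum_coord]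
    refine ⟨fun n => ((continuous_startSum n).div_const _).measurable.aemeasurable,
      hlim.aemeasurable_limit, ?_⟩
    rw [← map_atTop_of_strictMono hν]
    exact hlim.tendsto
  · rintro Q hQ ⟨a, b, ha, hab⟩
    obtain ⟨ν, hν, hmem, μ, hμ, hlim⟩ := hsub Q hQ
    have hZ := hab.comp hν hmem
    simp only [partialSum_coord] at hZ
    obtain ⟨m, v, hmv⟩ := exists_eq_gaussianReal_of_tendsto (stationaryLaw (2 * N)) _
      (fun i => a (ν i) * √(ν i : ℝ)) (fun i => b (ν i))
      (fun i => mul_nonneg (ha _ (hmem i)).le (Real.sqrt_nonneg _)) μ hlim (by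
        convert hZ using 3 with i x
        -- For index `0` the division by `√0` is harmless because the sum is empty.
        rcases Nat.eq_zero_or_pos (ν i) with h0 | h0
        · simp [h0, startSum]
        · have : √(ν i : ℝ) ≠ 0 := (Real.sqrt_pos.2 (by exact_mod_cast h0)).ne'
          field_simp)
    exact hμ m v hmv
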